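/- Let $d\ge 2$, let $G=\mathrm{SO}^\circ(d,1)$ be the identity component of $\mathrm{SO}(Q)$ for $Q(x)=2x_1x_{d+1}+x_2^2+\cdots+x_d^2$, acting on $\mathbb H^d$ and on its sphere at infinity $\mathbb S^{d-1}$, and let $\Gamma<G$ be a discrete torsion-free subgroup with limit set $\Lambda\subset\mathbb S^{d-1}$. Assume that $M=\Gamma\backslash\mathbb H^d$ is a convex cocompact hyperbolic manifold with non-empty Fuchsian ends: $\operatorname{core}M=\Gamma\backslash\operatorname{hull}(\Lambda)$ is compact, and $\mathbb S^{d-1}-\Lambda=\bigcup_{i=1}^\infty B_i$ is a dense union of infinitely many round balls $B_i$ with mutually disjoint closures. Let $N^{-}=\{\exp u^-(x):x\in\mathbb R^{d-1}\}$ and $N^{+}=\{\exp u^+(x):x\in\mathbb R^{d-1}\}$, where $$u^-(x)=\begin{pmatrix}0&x^t&0\\0&0&-x\\0&0&0\end{pmatrix},\qquad u^+(x)=\begin{pmatrix}0&0&0\\x&0&0\\0&-x^t&0\end{pmatrix},$$ be the two horospherical subgroups. For $g\in G$ let $g^+$ and $g^-$ in $\mathbb S^{d-1}$ be the isotropic lines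 spanned by $ge_1$ and $ge_{d+1}$ (the forward and backward end points of the geodesic of the frame $g$), and let $$\operatorname{RF}M=\{[g]\in\Gamma\backslash G:\ g^{+}\in\Lambda\text{ and }g^-\in\Lambda\}.$$ The double of $\operatorname{core}M$ along its boundary is a closed hyperbolic manifold; its systole is the length of its shortest closed geodesic. Then there is a constant $k>1$, depending only on the systole of the double of $\operatorname{core}M$ (in particular not otherwise on $d$ or $\Gamma$), such that for every one-parameter subgroup $\{u_t:t\in\mathbb R\}$ of $N^-$ or of $N^+$ and every $y\in\operatorname{RF}M$, the set $$\mathsf T(y)=\{t\in\mathbb R:\ yu_t\in\operatorname{RF}M\}$$ is globally $k$-thick, that is: $\mathsf T(y)$ is closed and non-empty, and for every $t\in\mathsf T(y)$ and every $\lambda>0$, $$\mathsf T(y)\cap\big([t-k\lambda,\,t-\lambda]\cup[t+\lambda,\,t+k\lambda]\big)\ne\emptyset .$$ -/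

import Mathlib

open Set Filter Topology

noncomputable section

namespace FuchsianEnds

/-! ### The form `Q`, the group `G = SO°(Q)` and hyperbolic space -/

/-- Coordinates `(x₁ ; x₂, …, x_d ; x_{d+1})` of `ℝ^{d+1}`: first, middle block of size `d - 1`,
last. -/
abbrev Idx (d : ℕ) : Type := Unit ⊕ (Fin (d - 1) ⊕ Unit)

/-- The space `ℝ^{d+1}`. -/
abbrev Vec (d : ℕ) : Type := Idx d → ℝ

/-- First coordinate. -/
abbrev fstI (d : ℕ) : Idx d := Sum.inl ()
/-- Middle coordinates. -/
abbrev midI {d : ℕ} (i : Fin (d - 1)) : Idx d := Sum.inr (Sum.inl i)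
/-- Last coordinate. -/
abbrev lstI (d : ℕ) : Idx d := Sum.inr (Sum.inr ())

/-- The symmetric bilinear form of `Q(x) = 2 x₁ x_{d+1} + x₂² + ⋯ + x_d²`. -/
def form {d : ℕ} (v w : Vec d) : ℝ :=
  v (fstI d) * w (lstI d) + v (lstI d) * w (fstI d) + ∑ i : Fin (d - 1), v (midI i) * w (midI i)

/-- `SO(Q)`: matrices of determinant one that preserve the form. -/
def SOQ (d : ℕ) : Subgroup (Matrix.SpecialLinearGroup (Idx d) ℝ) where
  carrier := {g | ∀ v w : Vec d, form (g.1.mulVec v) (g.1.mulVec w) = form v w}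
  one_mem' := by intro v w; simp
  mul_mem' := by
    intro a b ha hb v w
    have h := ha (b.1.mulVec v) (b.1.mulVec w)
    rw [hb] at h
    simpa [Matrix.mulVec_mulVec] using h
  inv_mem' := by
    intro a ha v w
    have h := ha (((a⁻¹ : Matrix.SpecialLinearGroup (Idx d) ℝ)).1.mulVec v)
      (((a⁻¹ : Matrix.SpecialLinearGroup (Idx d) ℝ)).1.mulVec w)
    have e : a.1 * ((a⁻¹ : Matrix.SpecialLinearGroup (Idx d) ℝ)).1 = 1 := by
      rw [← Matrix.SpecialLinearGroup.coe_mul, mul_inv_cancel,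
        Matrix.SpecialLinearGroup.coe_one]
    rw [Matrix.mulVec_mulVec, Matrix.mulVec_mulVec, e, Matrix.one_mulVec, Matrix.one_mulVec] at h
    exact h.symm

/-- `SO°(Q)`, the identity component of `SO(Q)`. -/
def SO0 (d : ℕ) : Subgroup (SOQ d) := Subgroup.connectedComponentOfOne (SOQ d)

/-- The Lie group `G = SO°(d,1)`, also the oriented frame bundle of `ℍ^d`. -/
abbrev G (d : ℕ) : Type := SO0 d

/-- The underlying matrix of an element of `G`. -/
def G.mat {d : ℕ} (g : G d) : Matrix (Idx d) (Idx d) ℝ := g.1.1.1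

/-- The linear functional `x₁ - x_{d+1}`; it does not vanish on vectors `x ≠ 0` with `Q(x) ≤ 0`. -/
def ht {d : ℕ} (v : Vec d) : ℝ := v (fstI d) - v (lstI d)

/-- Hyperbolic space `ℍ^d`: the sheet `x₁ > x_{d+1}` of the hyperboloid `Q = -1`. -/
def Hyp (d : ℕ) : Type := {v : Vec d // form v v = -1 ∧ 0 < ht v}

instance (d : ℕ) : TopologicalSpace (Hyp d) := instTopologicalSpaceSubtype

lemma ht_ne_zero {d : ℕ} {v : Vec d} (hv : form v v = -1) : ht v ≠ 0 := by
  intro h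
  have h0 : v (fstI d) = v (lstI d) := sub_eq_zero.mp h
  have h1 : 0 ≤ ∑ i : Fin (d - 1), v (midI i) * v (midI i) :=
    Finset.sum_nonneg fun i _ => mul_self_nonneg _
  unfold form at hv
  rw [h0] at hv
  nlinarith [mul_self_nonneg (v (lstI d))]

lemma form_mat {d : ℕ} (g : G d) (v w : Vec d) :
    form (g.mat.mulVec v) (g.mat.mulVec w) = form v w := g.1.2 v w

lemma ht_mat_pos {d : ℕ} (g : G d) (x : Hyp d) : 0 < ht (g.mat.mulVec x.1) := by
  let f : SOQ d → ℝ := fun a => ht (a.1.1.mulVec x.1)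
  have hf : Continuous f := by
    have h1 : Continuous fun a : SOQ d => a.1.1 :=
      continuous_subtype_val.comp continuous_subtype_val
    have h2 : Continuous fun a : SOQ d => a.1.1.mulVec x.1 :=
      h1.matrix_mulVec continuous_const
    exact ((continuous_pi_iff.mp h2) (fstI d)).sub ((continuous_pi_iff.mp h2) (lstI d))
  have hne : ∀ a, f a ≠ 0 := fun a => ht_ne_zero ((a.2 x.1 x.1).trans x.2.1)
  have h1 : 0 < f 1 := by simpa [f] using x.2.2
  by_contra hneg
  have hg : f g.1 ≤ 0 := not_lt.mp hneg
  have hc : IsPreconnected (connectedComponent (1 : SOQ d)) := isPreconnected_connectedComponent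
  obtain ⟨a, -, ha⟩ := hc.intermediate_value (f := f) (g.2 : g.1 ∈ connectedComponent (1 : SOQ d))
    mem_connectedComponent hf.continuousOn ⟨hg, h1.le⟩
  exact hne a ha

/-- `G` acts linearly on `ℍ^d`. -/
instance (d : ℕ) : MulAction (G d) (Hyp d) where
  smul g x := ⟨g.mat.mulVec x.1, (form_mat g x.1 x.1).trans x.2.1, ht_mat_pos g x⟩
  one_smul x := Subtype.ext (Matrix.one_mulVec x.1)
  mul_smul g h x := Subtype.ext (Matrix.mulVec_mulVec x.1 g.mat h.mat).symm

/-- The hyperbolic distance: `cosh d(x,y) = -⟨x,y⟩`. -/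
def hdist {d : ℕ} (x y : Hyp d) : ℝ := Real.arcosh (-form x.1 y.1)

/-- The point `o` with stabilizer `K = {g ∈ G | gᵗ g = 1}`: `o = (1, 0, …, 0, -1) / √2`. -/
def o (d : ℕ) : Hyp d :=
  ⟨Sum.elim (fun _ => (√2)⁻¹) (Sum.elim (fun _ => 0) (fun _ => -(√2)⁻¹)), by
    have h : (√2)⁻¹ * (√2)⁻¹ = (2 : ℝ)⁻¹ := by
      rw [← mul_inv, Real.mul_self_sqrt (by norm_num)]
    constructor
    · simp only [form, Sum.elim_inl, Sum.elim_inr, mul_zero, Finset.sum_const_zero]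
      linarith
    · simp only [ht, Sum.elim_inl, Sum.elim_inr]
      have : (0 : ℝ) < (√2)⁻¹ := by positivity
      linarith⟩

/-! ### The compactification `ℍ^d ∪ 𝕊^{d-1}` (projective model), limit set and convex hull -/

/-- The representative of the line `ℝ v` in the affine chart `x₁ - x_{d+1} = 1`. In this chart
`ℍ^d` is the open ball `Q < 0`, its sphere at infinity is `Q = 0`, and hyperbolic geodesics are
straight segments. -/
def klein {d : ℕ} (v : Vec d) : Vec d := (ht v)⁻¹ • v

/-- The sphere at infinity `𝕊^{d-1}` (isotropic lines). -/
def sphereInf (d : ℕ) : Set (Vec d) := {v | form v v = 0 ∧ ht v = 1}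

/-- `g⁺ = g(∞)`, where `∞ = e⁺ = lim_{t → ∞} a_t o` is the line of the first basis vector. -/
def G.plus {d : ℕ} (g : G d) : Vec d := klein (g.mat.mulVec (Pi.single (fstI d) 1))

/-- `g⁻ = g(0)`, where `0 = e⁻ = lim_{t → -∞} a_t o` is the line of the last basis vector. -/
def G.minus {d : ℕ} (g : G d) : Vec d := klein (g.mat.mulVec (Pi.single (lstI d) 1))

/-- The limit set `Λ ⊆ 𝕊^{d-1}`: all accumulation points at infinity of the orbit `Γ o` in the
compactification `ℍ^d ∪ 𝕊^{d-1}`. -/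
def limitSet {d : ℕ} (Γ : Subgroup (G d)) : Set (Vec d) :=
  {ξ ∈ sphereInf d | AccPt ξ (𝓟 (range fun γ : Γ => klein (γ • o d).1))}

/-- `hull(Λ) ⊆ ℍ^d`, the hyperbolic convex hull of the limit set; since geodesics are straight
segments in the projective model, it is the trace on `ℍ^d` of the affine convex hull. -/
def hull {d : ℕ} (Γ : Subgroup (G d)) : Set (Hyp d) :=
  {x | klein x.1 ∈ convexHull ℝ (limitSet Γ)}

/-- The open round ball of `𝕊^{d-1}` cut out by a spacelike vector `n` (a nonempty intersection of
the sphere with an open half-space, with nonempty exterior). -/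
def roundBall {d : ℕ} (n : Vec d) : Set (Vec d) := {ξ ∈ sphereInf d | 0 < form ξ n}

/-! ### The manifold `M = Γ \ ℍ^d`, its convex core and its frame bundle -/

/-- `M = Γ \ ℍ^d`, with the quotient topology. -/
abbrev Mfd {d : ℕ} (Γ : Subgroup (G d)) : Type := Quotient (MulAction.orbitRel Γ (Hyp d))

/-- `core M = Γ \ hull(Λ)`. -/
def core {d : ℕ} (Γ : Subgroup (G d)) : Set (Mfd Γ) := (fun x => (⟦x⟧ : Mfd Γ)) '' hull Γ

/-- `M = Γ \ ℍ^d` is a convex cocompact hyperbolic manifold with non-empty Fuchsian ends: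
`Γ` is discrete and torsion-free, `core M` is compact, and `Ω = 𝕊^{d-1} - Λ` is a dense union of
infinitely many round balls with mutually disjoint closures. -/
structure IsConvexCocompactFuchsianEnds {d : ℕ} (Γ : Subgroup (G d)) : Prop where
  discrete : DiscreteTopology Γ
  torsionFree : ∀ γ ∈ Γ, IsOfFinOrder γ → γ = 1
  isCompact_core : IsCompact (core Γ)
  exists_balls : ∃ n : ℕ → Vec d, (∀ i, form (n i) (n i) = 1) ∧
    sphereInf d \ limitSet Γ = ⋃ i, roundBall (n i) ∧
    Pairwise (fun i j => Disjoint (closure (roundBall (n i))) (closure (roundBall (n j)))) ∧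
    sphereInf d ⊆ closure (sphereInf d \ limitSet Γ)

/-- `Γ \ G`, the oriented frame bundle of `M`. -/
abbrev FrameBundle {d : ℕ} (Γ : Subgroup (G d)) : Type := Quotient (MulAction.orbitRel Γ (G d))

/-- The right translation `x ↦ x g` of `Γ \ G`. -/
def rightMul {d : ℕ} {Γ : Subgroup (G d)} (x : FrameBundle Γ) (g : G d) : FrameBundle Γ :=
  Quotient.map (· * g) (by
    rintro a b ⟨γ, rfl⟩
    exact ⟨γ, (smul_mul_assoc γ b g).symm⟩) x

/-- The renormalized frame bundle `RF M = {[g] ∈ Γ \ G | g⁺, g⁻ ∈ Λ}`. -/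
def RF {d : ℕ} (Γ : Subgroup (G d)) : Set (FrameBundle Γ) :=
  (fun g => (⟦g⟧ : FrameBundle Γ)) '' {g : G d | g.plus ∈ limitSet Γ ∧ g.minus ∈ limitSet Γ}

/-! ### The double of the convex core and its systole -/

/-- The distance of `M`: the infimum of the distances of representatives. As `hull(Λ)` is convex,
on `core M` it is also the intrinsic path distance of `core M`. -/
def mdist {d : ℕ} {Γ : Subgroup (G d)} (x y : Mfd Γ) : ℝ :=
  sInf {r | ∃ p q : Hyp d, (⟦p⟧ : Mfd Γ) = x ∧ (⟦q⟧ : Mfd Γ) = y ∧ r = hdist p q}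

/-- The boundary of `core M`. -/
def coreBoundary {d : ℕ} (Γ : Subgroup (G d)) : Set (Mfd Γ) := frontier (core Γ)

/-- Two copies of `core M`, the points of the boundary being identified with their copies. -/
def doubleSetoid {d : ℕ} (Γ : Subgroup (G d)) : Setoid (core Γ × Bool) where
  r p q := p.1 = q.1 ∧ (p.2 = q.2 ∨ p.1.1 ∈ coreBoundary Γ)
  iseqv :=
    { refl := fun _ => ⟨rfl, Or.inl rfl⟩
      symm := fun h => ⟨h.1.symm, h.2.elim (fun e => Or.inl e.symm)
        (fun e => Or.inr (h.1 ▸ e))⟩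
      trans := fun h k => ⟨h.1.trans k.1, h.2.elim
        (fun e => k.2.elim (fun e' => Or.inl (e.trans e')) (fun e' => Or.inr (h.1.symm ▸ e')))
        Or.inr⟩ }

/-- The double of `core M`. -/
abbrev Double {d : ℕ} (Γ : Subgroup (G d)) : Type := Quotient (doubleSetoid Γ)

/-- The path distance of the double (the gluing metric): two points of the same copy are joined
inside this copy, and any two points are joined by way of a point of the common boundary. -/
def ddist {d : ℕ} {Γ : Subgroup (G d)} (a b : Double Γ) : ℝ :=
  sInf ({r | ∃ (x y : core Γ) (i : Bool), (⟦(x, i)⟧ : Double Γ) = a ∧ (⟦(y, i)⟧ : Double Γ) = b ∧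
      r = mdist x.1 y.1} ∪
    {r | ∃ (x y z : core Γ) (i j : Bool), (⟦(x, i)⟧ : Double Γ) = a ∧
      (⟦(y, j)⟧ : Double Γ) = b ∧ z.1 ∈ coreBoundary Γ ∧ r = mdist x.1 z.1 + mdist z.1 y.1})

/-- The double contains a closed geodesic of length `ℓ > 0`: an `ℓ`-periodic, unit speed, locally
distance-realizing curve. -/
def HasClosedGeodesic {d : ℕ} (Γ : Subgroup (G d)) (ℓ : ℝ) : Prop :=
  0 < ℓ ∧ ∃ c : ℝ → Double Γ, (∀ t, c (t + ℓ) = c t) ∧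
    ∀ t, ∃ ε > 0, ∀ s ∈ Ioo (t - ε) (t + ε), ∀ s' ∈ Ioo (t - ε) (t + ε),
      ddist (c s) (c s') = |s - s'|

/-- `η` is the systole of the double of `core M`: the length of a shortest closed geodesic. -/
def IsSystoleOfDouble {d : ℕ} (Γ : Subgroup (G d)) (η : ℝ) : Prop :=
  IsLeast {ℓ | HasClosedGeodesic Γ ℓ} η

/-! ### Horospherical subgroups, one-parameter subgroups and thick sets -/

/-- The nilpotent matrix `u⁻(x)`. -/
def uMinus {d : ℕ} (x : Fin (d - 1) → ℝ) : Matrix (Idx d) (Idx d) ℝ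
  | Sum.inl _, Sum.inr (Sum.inl j) => x j
  | Sum.inr (Sum.inl i), Sum.inr (Sum.inr _) => -x i
  | _, _ => 0

/-- The nilpotent matrix `u⁺(x)`. -/
def uPlus {d : ℕ} (x : Fin (d - 1) → ℝ) : Matrix (Idx d) (Idx d) ℝ
  | Sum.inr (Sum.inl i), Sum.inl _ => x i
  | Sum.inr (Sum.inr _), Sum.inr (Sum.inl j) => -x j
  | _, _ => 0

/-- The contracting horospherical group `N⁻ = {exp u⁻(x)}`, as a subset of `G`. -/
def NMinus (d : ℕ) : Set (G d) := {g | ∃ x, g.mat = NormedSpace.exp (uMinus x)}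

/-- The expanding horospherical group `N⁺ = {exp u⁺(x)}`, as a subset of `G`. -/
def NPlus (d : ℕ) : Set (G d) := {g | ∃ x, g.mat = NormedSpace.exp (uPlus x)}

/-- `u` is a one-parameter subgroup of `G`: a continuous homomorphism from `(ℝ, +)`. -/
def IsOneParameterSubgroup {d : ℕ} (u : ℝ → G d) : Prop :=
  Continuous u ∧ ∀ s t, u (s + t) = u s * u t

/-- The return times `{t ∈ ℝ | y u_t ∈ RF M}`. -/
def returnTimes {d : ℕ} {Γ : Subgroup (G d)} (u : ℝ → G d) (y : FrameBundle Γ) : Set ℝ :=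
  {t | rightMul y (u t) ∈ RF Γ}

/-- `T` is locally `k`-thick at `t`: `T ∩ (t ± [r, k r]) ≠ ∅` for every `r > 0`. -/
def LocallyThickAt (k : ℝ) (T : Set ℝ) (t : ℝ) : Prop :=
  ∀ r > 0, (T ∩ (Icc (t - k * r) (t - r) ∪ Icc (t + r) (t + k * r))).Nonempty

/-- `T` is globally `k`-thick: closed, nonempty, and locally `k`-thick at each of its points. -/
def GloballyThick (k : ℝ) (T : Set ℝ) : Prop :=
  IsClosed T ∧ T.Nonempty ∧ ∀ t ∈ T, LocallyThickAt k T t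

end FuchsianEnds

end

/-!
The frame `g` moves along a one-parameter horospherical group as a horocycle based at `g⁺` (or
`g⁻`) moves its other end point. If the `k`-thickness fails at some scale, each of the two arcs
`±[r, k r]` of the horocycle avoids `Λ`, hence lies in one of the balls `B_i`, and the two balls
are distinct. For unit normals `n`, `m` of their boundary hyperplanes, Bessel's inequality along the
horocycle gives `-⟨n, m⟩ ≤ 1 + 8 / (k - 4)`: for large `k` the two hyperplanes are almost as close
as if the balls were tangent. On the other hand the closures of the balls are disjoint, so the two
hyperplanes have a common perpendicular; it meets the boundary of the core orthogonally at both
ends, so its length `D`, with `cosh D = -⟨n, m⟩`, doubles to a closed geodesic of length `2 D`.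
Therefore `2 D` is at least the systole `η`, and `cosh (η / 2) ≤ -⟨n, m⟩` bounds `k`.
-/

noncomputable section

namespace FuchsianEnds

variable {d : ℕ}

/-! ### Causal vectors -/

section Form

lemma form_comm (v w : Vec d) : form v w = form w v := by
  simp only [form, mul_comm]
  ring

lemma form_add_left (u v w : Vec d) : form (u + v) w = form u w + form v w := by
  simp only [form, Pi.add_apply, add_mul, Finset.sum_add_distrib]
  ring

lemma form_smul_left (a : ℝ) (v w : Vec d) : form (a • v) w = a * form v w := by
  simp only [form, Pi.smul_apply, smul_eq_mul, mul_add, Finset.mul_sum, mul_assoc]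

lemma form_add_right (u v w : Vec d) : form u (v + w) = form u v + form u w := by
  rw [form_comm, form_add_left, form_comm v, form_comm w]

lemma form_smul_right (a : ℝ) (v w : Vec d) : form v (a • w) = a * form v w := by
  rw [form_comm, form_smul_left, form_comm w]

/-- `form` as a bundled bilinear form, giving access to the library on bilinear forms. -/
def formBilin (d : ℕ) : LinearMap.BilinForm ℝ (Vec d) :=
  LinearMap.mk₂ ℝ form form_add_left form_smul_left form_add_right form_smul_right

lemma form_neg_left (v w : Vec d) : form (-v) w = -form v w := (formBilin d).map_neg₂ v w

lemma form_neg_right (v w : Vec d) : form v (-w) = -form v w := (formBilin d v).map_neg w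

lemma form_sub_left (u v w : Vec d) : form (u - v) w = form u w - form v w :=
  (formBilin d).map_sub₂ u v w

lemma form_sub_right (u v w : Vec d) : form u (v - w) = form u v - form u w :=
  (formBilin d u).map_sub v w

lemma form_zero_left (w : Vec d) : form 0 w = 0 := (formBilin d).map_zero₂ w

lemma continuous_form : Continuous fun p : Vec d × Vec d => form p.1 p.2 := by
  unfold form
  fun_prop

lemma ht_add (v w : Vec d) : ht (v + w) = ht v + ht w := by
  simp only [ht, Pi.add_apply]; ring

lemma ht_smul (a : ℝ) (v : Vec d) : ht (a • v) = a * ht v := by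
  simp only [ht, Pi.smul_apply, smul_eq_mul]; ring

lemma ht_neg (v : Vec d) : ht (-v) = -ht v := by
  simp only [ht, Pi.neg_apply]; ring

lemma continuous_ht : Continuous (ht : Vec d → ℝ) := by
  unfold ht
  fun_prop

/-- The orthogonal projection to the Euclidean space on which `ht` vanishes, in orthonormal
coordinates. -/
def spacePart (v : Vec d) : EuclideanSpace ℝ (Option (Fin (d - 1))) :=
  WithLp.toLp 2 fun i => i.elim ((v (fstI d) + v (lstI d)) / √2) fun j => v (midI j)

lemma form_eq_inner (v w : Vec d) :
    form v w = inner ℝ (spacePart v) (spacePart w) - ht v * ht w / 2 := by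
  have h2 : √(2 : ℝ) * √2 = 2 := Real.mul_self_sqrt zero_le_two
  simp only [form, spacePart, ht, PiLp.inner_apply, Fintype.sum_option, Option.elim_none,
    Option.elim_some, RCLike.inner_apply, conj_trivial, div_mul_div_comm, h2, mul_comm (w _)]
  ring

lemma form_self (v : Vec d) : form v v = ‖spacePart v‖ ^ 2 - ht v ^ 2 / 2 := by
  rw [form_eq_inner, real_inner_self_eq_norm_sq, sq (ht v)]

lemma eq_zero_of_ht_eq_zero {v : Vec d} (hv : form v v ≤ 0) (h : ht v = 0) : v = 0 := by
  have hs : spacePart v = 0 := by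
    rw [form_self, h] at hv
    exact norm_eq_zero.mp (pow_eq_zero_iff two_ne_zero |>.mp
      (by linarith [sq_nonneg ‖spacePart v‖]))
  have h1 : (v (fstI d) + v (lstI d)) / √2 = 0 := congr($hs none)
  rw [div_eq_zero_iff, or_iff_left (by positivity)] at h1
  unfold ht at h
  funext i
  rcases i with ⟨⟩ | i | ⟨⟩
  · exact show v (fstI d) = 0 by linarith
  · exact congr($hs (some i))
  · exact show v (lstI d) = 0 by linarith

lemma form_neg_of_ht_pos {v y : Vec d} (hv : form v v ≤ 0) (hv0 : 0 < ht v) (hy : form y y < 0)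
    (hy0 : 0 < ht y) : form v y < 0 := by
  rw [form_self] at hv hy
  rw [form_eq_inner]
  have h : (‖spacePart v‖ * ‖spacePart y‖) ^ 2 < (ht v * ht y / 2) ^ 2 := by
    nlinarith [mul_le_mul_of_nonneg_right (sub_nonpos.mp hv) (sq_nonneg ‖spacePart y‖),
      mul_lt_mul_of_pos_left (sub_neg.mp hy) (half_pos (pow_pos hv0 2))]
  linarith [real_inner_le_norm (spacePart v) (spacePart y),
    lt_of_pow_lt_pow_left₀ 2 (by positivity) h]

lemma form_ne_zero_of_timelike {v y : Vec d} (hv : form v v ≤ 0) (hv0 : v ≠ 0)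
    (hy : form y y < 0) : form v y ≠ 0 := by
  wlog hvt : 0 < ht v generalizing v
  · have := this (v := -v) (by simpa only [form_neg_left, form_neg_right, neg_neg])
      (neg_ne_zero.mpr hv0)
      (by
        rw [ht_neg, neg_pos]
        exact (not_lt.mp hvt).lt_of_ne fun h => hv0 (eq_zero_of_ht_eq_zero hv h))
    rwa [form_neg_left, neg_ne_zero] at this
  rcases lt_trichotomy (ht y) 0 with h | h | h
  · have := form_neg_of_ht_pos hv hvt (y := -y)
      (by simpa only [form_neg_left, form_neg_right, neg_neg]) (by rwa [ht_neg, neg_pos])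
    rw [form_neg_right, neg_lt_zero] at this
    exact this.ne'
  · rw [eq_zero_of_ht_eq_zero hy.le h, form_zero_left] at hy
    exact absurd hy (lt_irrefl 0)
  · exact (form_neg_of_ht_pos hv hvt hy h).ne

lemma ht_pos_of_form_neg {v y : Vec d} (hv : form v v ≤ 0) (hy : form y y < 0) (hy0 : 0 < ht y)
    (h : form v y < 0) : 0 < ht v := by
  by_contra! hvt
  rcases hvt.eq_or_lt with h0 | h0
  · rw [eq_zero_of_ht_eq_zero hv h0, form_zero_left] at h
    exact lt_irrefl 0 h
  · have := form_neg_of_ht_pos (v := -v) (by simpa only [form_neg_left, form_neg_right, neg_neg])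
      (by rwa [ht_neg, neg_pos]) hy hy0
    rw [form_neg_left] at this
    linarith

lemma form_self_pos_of_orthogonal {y w : Vec d} (hy : form y y < 0) (hw : form w y = 0)
    (hw0 : w ≠ 0) : 0 < form w w := by
  by_contra! h
  exact form_ne_zero_of_timelike h hw0 hy hw

lemma form_self_nonneg_of_orthogonal {y w : Vec d} (hy : form y y < 0) (hw : form w y = 0) :
    0 ≤ form w w := by
  rcases eq_or_ne w 0 with rfl | h
  · exact (form_zero_left 0).ge
  · exact (form_self_pos_of_orthogonal hy hw h).le

lemma form_sq_le_of_orthogonal {y v w : Vec d} (hy : form y y < 0) (hv : form v y = 0)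
    (hw : form w y = 0) : form v w ^ 2 ≤ form v v * form w w :=
  ((formBilin d).restrict ((formBilin d).flip y).ker).apply_sq_le_of_symm
    (fun x => form_self_nonneg_of_orthogonal hy x.2) ⟨fun x z => form_comm x.1 z.1⟩ ⟨v, hv⟩ ⟨w, hw⟩

lemma exists_unit_orthogonal (hd : 2 ≤ d) {y : Vec d} (hy : form y y < 0) (n : Vec d) :
    ∃ v, form v v = 1 ∧ form v y = 0 ∧ form v n = 0 := by
  let F : Vec d →ₗ[ℝ] ℝ × ℝ := ((formBilin d).flip y).prod ((formBilin d).flip n)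
  have hlt : Module.finrank ℝ (ℝ × ℝ) < Module.finrank ℝ (Vec d) := by
    simp only [Module.finrank_prod, Module.finrank_self, Module.finrank_fintype_fun_eq_card,
      Fintype.card_fin, Fintype.card_sum, Fintype.card_unit]
    omega
  obtain ⟨v, hv, hv0⟩ := (Submodule.ne_bot_iff _).mp (LinearMap.ker_ne_bot_of_finrank_lt hlt)
  have hvy : form v y = 0 := congrArg Prod.fst (hv : F v = 0)
  have hvn : form v n = 0 := congrArg Prod.snd (hv : F v = 0)
  have hpos := form_self_pos_of_orthogonal hy hvy hv0
  refine ⟨(√(form v v))⁻¹ • v, ?_, by simp [form_smul_left, hvy], by simp [form_smul_left, hvn]⟩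
  rw [form_smul_left, form_smul_right, ← mul_assoc, ← mul_inv, Real.mul_self_sqrt hpos.le,
    inv_mul_cancel₀ hpos.ne']

end Form

/-! ### Hyperbolic distance -/

section Distance

/-- The point of `ℍ^d` on the ray spanned by a future timelike vector. -/
def normalize (v : Vec d) (hv : form v v < 0) (hv0 : 0 < ht v) : Hyp d :=
  ⟨(√(-form v v))⁻¹ • v, by
    rw [form_smul_left, form_smul_right, ← mul_assoc, ← mul_inv,
      Real.mul_self_sqrt (by linarith), inv_neg, neg_mul, inv_mul_cancel₀ hv.ne], by
    rw [ht_smul]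
    exact mul_pos (inv_pos.mpr (Real.sqrt_pos.mpr (by linarith))) hv0⟩

lemma form_hyp_self_neg (x : Hyp d) : form x.1 x.1 < 0 := by rw [x.2.1]; norm_num

lemma form_hyp_neg {v : Vec d} (hv : form v v ≤ 0) (hv0 : 0 < ht v) (x : Hyp d) :
    form v x.1 < 0 :=
  form_neg_of_ht_pos hv hv0 (form_hyp_self_neg x) x.2.2

lemma form_add_smul_hyp_self (y : Hyp d) (v : Vec d) : form (v + form v y.1 • y.1) y.1 = 0 := by
  rw [form_add_left, form_smul_left, y.2.1]; ring

lemma form_add_smul_hyp (y : Hyp d) (v w : Vec d) :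
    form (v + form v y.1 • y.1) (w + form w y.1 • y.1) = form v w + form v y.1 * form w y.1 := by
  rw [form_add_right, form_smul_right, form_add_smul_hyp_self, form_add_left, form_smul_left,
    form_comm y.1]
  ring

lemma form_self_add_sq_nonneg (y : Hyp d) (v : Vec d) : 0 ≤ form v v + form v y.1 * form v y.1 := by
  rw [← form_add_smul_hyp]
  exact form_self_nonneg_of_orthogonal (form_hyp_self_neg y) (form_add_smul_hyp_self y v)

lemma form_add_mul_sq_le (y : Hyp d) (v w : Vec d) :
    (form v w + form v y.1 * form w y.1) ^ 2 ≤
      (form v v + form v y.1 * form v y.1) * (form w w + form w y.1 * form w y.1) := by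
  simp only [← form_add_smul_hyp]
  exact form_sq_le_of_orthogonal (form_hyp_self_neg y) (form_add_smul_hyp_self y v)
    (form_add_smul_hyp_self y w)

lemma one_le_neg_form (x y : Hyp d) : 1 ≤ -form x.1 y.1 := by
  have hneg := form_hyp_neg (form_hyp_self_neg x).le x.2.2 y
  have hsq := form_self_add_sq_nonneg y x.1
  rw [x.2.1] at hsq
  nlinarith

lemma cosh_hdist (x y : Hyp d) : Real.cosh (hdist x y) = -form x.1 y.1 :=
  Real.cosh_arcosh (one_le_neg_form x y)

lemma hdist_nonneg (x y : Hyp d) : 0 ≤ hdist x y := Real.arcosh_nonneg (one_le_neg_form x y)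

lemma sinh_hdist_nonneg (x y : Hyp d) : 0 ≤ Real.sinh (hdist x y) :=
  Real.sinh_nonneg_iff.mpr (hdist_nonneg x y)

lemma sinh_hdist_sq (x y : Hyp d) :
    Real.sinh (hdist x y) ^ 2 = -1 + form x.1 y.1 * form x.1 y.1 := by
  rw [Real.sinh_sq, cosh_hdist]; ring

lemma hdist_comm (x y : Hyp d) : hdist x y = hdist y x := by
  unfold hdist; rw [form_comm]

lemma hdist_le_iff {x y : Hyp d} {r : ℝ} (hr : 0 ≤ r) :
    hdist x y ≤ r ↔ -form x.1 y.1 ≤ Real.cosh r := by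
  rw [← cosh_hdist, Real.cosh_le_cosh, abs_of_nonneg (hdist_nonneg x y), abs_of_nonneg hr]

lemma le_hdist_iff {x y : Hyp d} {r : ℝ} (hr : 0 ≤ r) :
    r ≤ hdist x y ↔ Real.cosh r ≤ -form x.1 y.1 := by
  rw [← cosh_hdist, Real.cosh_le_cosh, abs_of_nonneg (hdist_nonneg x y), abs_of_nonneg hr]

lemma hdist_eq_of_neg_form_eq_cosh {x y : Hyp d} {r : ℝ} (h : -form x.1 y.1 = Real.cosh r) :
    hdist x y = |r| := by
  rw [hdist, h, ← Real.cosh_abs, Real.arcosh_cosh (abs_nonneg r)]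

lemma hdist_self (x : Hyp d) : hdist x x = 0 := by
  simpa using hdist_eq_of_neg_form_eq_cosh (x := x) (y := x) (r := 0) (by simp [x.2.1])

lemma eq_of_hdist_eq_zero {x y : Hyp d} (h : hdist x y = 0) : x = y := by
  have hform : form x.1 y.1 = -1 := by
    linarith [(cosh_hdist x y).symm.trans (by rw [h, Real.cosh_zero])]
  by_contra hne
  have hpos := form_self_pos_of_orthogonal (form_hyp_self_neg y)
    (by rw [form_sub_left, hform, y.2.1, sub_self])
    (sub_ne_zero.mpr fun h => hne (Subtype.ext h))
  simp only [form_sub_left, form_sub_right, x.2.1, y.2.1, form_comm y.1 x.1, hform] at hpos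
  linarith

lemma hdist_triangle (x y z : Hyp d) : hdist x z ≤ hdist x y + hdist y z := by
  rw [hdist_le_iff (add_nonneg (hdist_nonneg _ _) (hdist_nonneg _ _)), Real.cosh_add,
    cosh_hdist, cosh_hdist, hdist_comm y z, form_comm y.1 z.1]
  have hcs : (form x.1 z.1 + form x.1 y.1 * form z.1 y.1) ^ 2 ≤
      (Real.sinh (hdist x y) * Real.sinh (hdist z y)) ^ 2 := by
    rw [mul_pow, sinh_hdist_sq, sinh_hdist_sq]
    simpa only [x.2.1, z.2.1] using form_add_mul_sq_le y x.1 z.1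
  linarith [(abs_le_of_sq_le_sq' hcs
    (mul_nonneg (sinh_hdist_nonneg x y) (sinh_hdist_nonneg z y))).1]

lemma hdist_smul (g : G d) (x y : Hyp d) : hdist (g • x) (g • y) = hdist x y :=
  congrArg (fun r => Real.arcosh (-r)) (form_mat g x.1 y.1)

lemma abs_form_le_sinh_hdist {p : Hyp d} {n : Vec d} (hn : form n n = 1) (hp : form p.1 n = 0)
    (z : Hyp d) : |form z.1 n| ≤ Real.sinh (hdist z p) := by
  refine abs_le_of_sq_le_sq ?_ (sinh_hdist_nonneg z p)
  have h := form_add_mul_sq_le p z.1 n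
  rw [hn, z.2.1, form_comm n, hp] at h
  linarith [sinh_hdist_sq z p]

end Distance

/-! ### The limit set and its convex hull -/

section LimitSet

lemma mulVec_mul (g h : G d) (v : Vec d) :
    (g * h).mat.mulVec v = g.mat.mulVec (h.mat.mulVec v) :=
  (Matrix.mulVec_mulVec v g.mat h.mat).symm

lemma mulVec_inv_mulVec (g : G d) (v : Vec d) : g⁻¹.mat.mulVec (g.mat.mulVec v) = v := by
  rw [← mulVec_mul, inv_mul_cancel]; exact Matrix.one_mulVec v

lemma continuous_mulVec (g : G d) : Continuous fun v => g.mat.mulVec v :=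
  continuous_const.matrix_mulVec continuous_id

lemma ht_mulVec_pos (g : G d) {v : Vec d} (hv : form v v ≤ 0) (hv0 : 0 < ht v) :
    0 < ht (g.mat.mulVec v) :=
  ht_pos_of_form_neg ((form_mat g v v).trans_le hv) (form_hyp_self_neg (g • o d)) (g • o d).2.2
    ((form_mat g v (o d).1).trans_lt (form_hyp_neg hv hv0 (o d)))

lemma ht_klein {v : Vec d} (h : ht v ≠ 0) : ht (klein v) = 1 := by
  rw [klein, ht_smul, inv_mul_cancel₀ h]

lemma klein_smul {a : ℝ} (ha : a ≠ 0) (v : Vec d) : klein (a • v) = klein v := by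
  rw [klein, klein, ht_smul, smul_smul, mul_inv_rev, inv_mul_cancel_right₀ ha]

lemma klein_eq_self {v : Vec d} (h : ht v = 1) : klein v = v := by
  rw [klein, h, inv_one, one_smul]

lemma smul_klein {v : Vec d} (h : ht v ≠ 0) : ht v • klein v = v := by
  rw [klein, smul_smul, mul_inv_cancel₀ h, one_smul]

lemma form_klein_left (v w : Vec d) : form (klein v) w = (ht v)⁻¹ * form v w :=
  form_smul_left _ _ _

lemma form_klein_self (v : Vec d) : form (klein v) (klein v) = (ht v)⁻¹ ^ 2 * form v v := by
  rw [klein, form_smul_left, form_smul_right, ← mul_assoc, sq]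

lemma klein_mulVec_klein (g : G d) {v : Vec d} (h : ht v ≠ 0) :
    klein (g.mat.mulVec (klein v)) = klein (g.mat.mulVec v) := by
  rw [klein.eq_1 v, Matrix.mulVec_smul, klein_smul (inv_ne_zero h)]

lemma klein_mem_sphereInf {v : Vec d} (hv : form v v = 0) (hv0 : ht v ≠ 0) :
    klein v ∈ sphereInf d :=
  ⟨by rw [form_klein_self, hv, mul_zero], ht_klein hv0⟩

lemma continuousAt_klein {v : Vec d} (h : ht v ≠ 0) : ContinuousAt klein v :=
  (continuous_ht.continuousAt.inv₀ h).smul continuousAt_id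

lemma isClosed_sphereInf : IsClosed (sphereInf d) :=
  (isClosed_eq (continuous_form.comp (continuous_id.prodMk continuous_id)) continuous_const).inter
    (isClosed_eq continuous_ht continuous_const)

lemma ht_pos_of_mem_sphereInf {ξ : Vec d} (hξ : ξ ∈ sphereInf d) : 0 < ht ξ := by
  rw [hξ.2]; exact one_pos

lemma klein_hyp_notMem_sphereInf (x : Hyp d) : klein x.1 ∉ sphereInf d := by
  intro h
  have hx := h.1
  rw [form_klein_self, x.2.1] at hx
  linarith [pow_pos (inv_pos.mpr x.2.2) 2]

variable {Γ : Subgroup (G d)}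

lemma isClosed_limitSet (Γ : Subgroup (G d)) : IsClosed (limitSet Γ) :=
  isClosed_sphereInf.inter (isClosed_derivedSet _)

lemma klein_mulVec_mem_limitSet {γ : G d} (hγ : γ ∈ Γ) {ξ : Vec d} (hξ : ξ ∈ limitSet Γ) :
    klein (γ.mat.mulVec ξ) ∈ limitSet Γ := by
  have hpos : 0 < ht (γ.mat.mulVec ξ) :=
    ht_mulVec_pos γ hξ.1.1.le (ht_pos_of_mem_sphereInf hξ.1)
  have hsphere : klein (γ.mat.mulVec ξ) ∈ sphereInf d :=
    klein_mem_sphereInf ((form_mat γ ξ ξ).trans hξ.1.1) hpos.ne'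
  have hlim : Tendsto (fun v => klein (γ.mat.mulVec v)) (𝓝 ξ) (𝓝 (klein (γ.mat.mulVec ξ))) :=
    (continuousAt_klein hpos.ne').comp_of_eq (continuous_mulVec γ).continuousAt rfl
  refine ⟨hsphere, accPt_iff_frequently.mpr
    (hlim.frequently ((accPt_iff_frequently.mp hξ.2).mono ?_))⟩
  rintro _ ⟨-, γ', rfl⟩
  have horbit : klein (((⟨γ, hγ⟩ : Γ) * γ') • o d).1 =
      klein (γ.mat.mulVec (klein (γ' • o d).1)) := by
    rw [klein_mulVec_klein γ (γ' • o d).2.2.ne', mul_smul]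
    rfl
  refine ⟨?_, (⟨γ, hγ⟩ : Γ) * γ', horbit⟩
  rw [← horbit]
  exact fun h => klein_hyp_notMem_sphereInf _ (h ▸ hsphere)

lemma klein_mulVec_mem_limitSet_iff {γ : G d} (hγ : γ ∈ Γ) {v : Vec d} (hv : form v v = 0)
    (hv0 : 0 < ht v) : klein (γ.mat.mulVec v) ∈ limitSet Γ ↔ klein v ∈ limitSet Γ := by
  have hpos := ht_mulVec_pos γ hv.le hv0
  refine ⟨fun h => ?_, fun h => ?_⟩
  · simpa only [klein_mulVec_klein _ hpos.ne', mulVec_inv_mulVec] using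
      klein_mulVec_mem_limitSet (Γ.inv_mem hγ) h
  · simpa only [klein_mulVec_klein _ hv0.ne'] using klein_mulVec_mem_limitSet hγ h

/-- The cone over the convex hull of the limit set; `hull Γ` is its trace on `ℍ^d`. -/
def hullCone (Γ : Subgroup (G d)) : ConvexCone ℝ (Vec d) where
  carrier := {v | 0 < ht v ∧ klein v ∈ convexHull ℝ (limitSet Γ)}
  smul_mem' a ha v hv :=
    ⟨by rw [ht_smul]; exact mul_pos ha hv.1, by rw [klein_smul ha.ne']; exact hv.2⟩
  add_mem' v hv w hw := by
    have hv0 := hv.1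
    have hw0 := hw.1
    refine ⟨by rw [ht_add]; exact add_pos hv0 hw0, ?_⟩
    have hcomb : klein (v + w) =
        (ht v / (ht v + ht w)) • klein v + (ht w / (ht v + ht w)) • klein w := by
      rw [klein, klein, klein, ht_add, smul_smul, smul_smul, smul_add]
      congr 2 <;> field_simp
    rw [hcomb]
    exact convex_convexHull ℝ _ hv.2 hw.2 (by positivity) (by positivity) (by field_simp)

lemma mem_hullCone_of_klein_mem_limitSet {v : Vec d} (hv0 : 0 < ht v)
    (hv : klein v ∈ limitSet Γ) : v ∈ hullCone Γ :=
  ⟨hv0, subset_convexHull ℝ _ hv⟩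

lemma hullCone_le {C : ConvexCone ℝ (Vec d)} (hC : limitSet Γ ⊆ C) : hullCone Γ ≤ C := by
  intro v hv
  rw [← smul_klein hv.1.ne']
  exact C.smul_mem hv.1 (convexHull_min hC C.convex hv.2)

lemma mem_hull_iff {x : Hyp d} : x ∈ hull Γ ↔ x.1 ∈ hullCone Γ :=
  ⟨fun h => ⟨x.2.2, h⟩, fun h => h.2⟩

lemma mulVec_mem_hullCone {γ : G d} (hγ : γ ∈ Γ) {v : Vec d} (hv : v ∈ hullCone Γ) :
    γ.mat.mulVec v ∈ hullCone Γ :=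
  hullCone_le (C := (hullCone Γ).comap γ.mat.mulVecLin) (fun _ hξ =>
    mem_hullCone_of_klein_mem_limitSet
      (ht_mulVec_pos γ hξ.1.1.le (ht_pos_of_mem_sphereInf hξ.1))
      (klein_mulVec_mem_limitSet hγ hξ)) hv

lemma smul_mem_hull (γ : Γ) {x : Hyp d} (hx : x ∈ hull Γ) : γ • x ∈ hull Γ :=
  mem_hull_iff.mpr (mulVec_mem_hullCone γ.2 (mem_hull_iff.mp hx))

lemma form_nonpos_of_mem_hullCone {n : Vec d} (hn : ∀ ξ ∈ limitSet Γ, form ξ n ≤ 0) {v : Vec d}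
    (hv : v ∈ hullCone Γ) : form v n ≤ 0 :=
  neg_nonneg.mp <| hullCone_le (C := (ConvexCone.positive ℝ ℝ).comap (-(formBilin d).flip n))
    (fun ξ hξ => neg_nonneg.mpr (hn ξ hξ)) hv

end LimitSet

/-! ### Horocycles -/

/-- Two null vectors `a`, `b` of product `-1` and a vector `w` orthogonal to both. The
unipotent one-parameter group fixing `a` with direction `w` moves `b` along `horocycle a b w`. -/
structure IsHorocyclicFrame (a b w : Vec d) : Prop where
  null_left : form a a = 0
  null_right : form b b = 0
  form_eq : form a b = -1
  orth_left : form w a = 0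
  orth_right : form w b = 0
  ht_left : 0 < ht a
  ht_right : 0 < ht b

/-- The horocyclic curve of null vectors through `b`, which tends to the point at infinity `a`. -/
def horocycle (a b w : Vec d) (s : ℝ) : Vec d := b + s • w + (s ^ 2 * form w w / 2) • a

lemma form_horocycle (a b w n : Vec d) (s : ℝ) :
    form (horocycle a b w s) n = form b n + s * form w n + s ^ 2 * form w w / 2 * form a n := by
  simp only [horocycle, form_add_left, form_smul_left]

lemma horocycle_neg (a b w : Vec d) (s : ℝ) : horocycle a b (-w) s = horocycle a b w (-s) := by
  simp only [horocycle, form_neg_left, form_neg_right, neg_neg, even_two.neg_pow, smul_neg,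
    neg_smul]

lemma continuous_horocycle (a b w : Vec d) : Continuous (horocycle a b w) := by
  unfold horocycle
  fun_prop

lemma neg_form_left_mul_lt {a b w n : Vec d} {s : ℝ} (hs0 : 0 < s)
    (hs : 0 < form (horocycle a b w s) n) (hbn : form b n ≤ 0) :
    -form a n * (s * form w w) < 2 * form w n := by
  rw [form_horocycle] at hs
  have hs' : 0 < s * (form w n + s * form w w / 2 * form a n) := by linarith
  linarith [pos_of_mul_pos_right hs' hs0.le]

lemma mul_mul_le_two_mul_sq {α β Ω k r ρ : ℝ} (hr : 0 < r) (hα0 : 0 ≤ α * (k * r * ρ)) (hβ0 : 0 ≤ β)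
    (hα : α * (k * r * ρ) ≤ 2 * Ω) (hβ : β ≤ r * Ω) : α * β * (k * ρ) ≤ 2 * Ω ^ 2 := by
  refine le_of_mul_le_mul_left ?_ hr
  calc r * (α * β * (k * ρ)) = β * (α * (k * r * ρ)) := by ring
    _ ≤ r * Ω * (2 * Ω) := mul_le_mul hβ hα hα0 (hβ0.trans hβ)
    _ = r * (2 * Ω ^ 2) := by ring

namespace IsHorocyclicFrame

variable {a b w : Vec d} (h : IsHorocyclicFrame a b w)

include h

lemma swap : IsHorocyclicFrame b a w :=
  ⟨h.null_right, h.null_left, (form_comm b a).trans h.form_eq, h.orth_right, h.orth_left,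
    h.ht_right, h.ht_left⟩

lemma neg : IsHorocyclicFrame a b (-w) :=
  { h with
    orth_left := by rw [form_neg_left, h.orth_left, neg_zero]
    orth_right := by rw [form_neg_left, h.orth_right, neg_zero] }

lemma mulVec (g : G d) :
    IsHorocyclicFrame (g.mat.mulVec a) (g.mat.mulVec b) (g.mat.mulVec w) where
  null_left := (form_mat g a a).trans h.null_left
  null_right := (form_mat g b b).trans h.null_right
  form_eq := (form_mat g a b).trans h.form_eq
  orth_left := (form_mat g w a).trans h.orth_left
  orth_right := (form_mat g w b).trans h.orth_right
  ht_left := ht_mulVec_pos g h.null_left.le h.ht_left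
  ht_right := ht_mulVec_pos g h.null_right.le h.ht_right

lemma form_add_self_neg : form (a + b) (a + b) < 0 := by
  simp only [form_add_left, form_add_right, h.null_left, h.null_right, form_comm b a, h.form_eq]
  norm_num

lemma form_add_right_eq_zero : form w (a + b) = 0 := by
  rw [form_add_right, h.orth_left, h.orth_right, add_zero]

lemma form_self_nonneg : 0 ≤ form w w :=
  form_self_nonneg_of_orthogonal h.form_add_self_neg h.form_add_right_eq_zero

lemma eq_zero_of_form_self_eq_zero (hw : form w w = 0) : w = 0 := by
  by_contra hw0
  exact (form_self_pos_of_orthogonal h.form_add_self_neg h.form_add_right_eq_zero hw0).ne' hw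

lemma form_horocycle_self (s : ℝ) : form (horocycle a b w s) (horocycle a b w s) = 0 := by
  simp only [horocycle, form_add_left, form_add_right, form_smul_left, form_smul_right,
    h.null_left, h.null_right, form_comm b a, form_comm a w, form_comm b w, h.form_eq,
    h.orth_left, h.orth_right]
  ring

lemma ht_horocycle_pos (s : ℝ) : 0 < ht (horocycle a b w s) := by
  refine ht_pos_of_form_neg (h.form_horocycle_self s).le h.form_add_self_neg
    (by rw [ht_add]; exact add_pos h.ht_left h.ht_right) ?_
  rw [form_horocycle, h.form_add_right_eq_zero]
  simp only [form_add_right, h.null_left, h.null_right, form_comm b a, h.form_eq]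
  linarith [mul_nonneg (sq_nonneg s) h.form_self_nonneg]

lemma form_perp_add_eq_zero (z : Vec d) :
    form (z + form b z • a + form a z • b) (a + b) = 0 := by
  simp only [form_add_left, form_add_right, form_smul_left, h.null_left, h.null_right,
    form_comm b a, h.form_eq, form_comm z]
  ring

lemma form_perp_self (z : Vec d) :
    form (z + form b z • a + form a z • b) (z + form b z • a + form a z • b) =
      form z z + 2 * (form a z * form b z) := by
  simp only [form_add_left, form_add_right, form_smul_left, form_smul_right, h.null_left,
    h.null_right, form_comm b a, h.form_eq, form_comm z a, form_comm z b]
  ring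

lemma form_self_add_nonneg (z : Vec d) : 0 ≤ form z z + 2 * (form a z * form b z) := by
  rw [← h.form_perp_self]
  exact form_self_nonneg_of_orthogonal h.form_add_self_neg (h.form_perp_add_eq_zero z)

lemma form_sq_le (z : Vec d) :
    form w z ^ 2 ≤ form w w * (form z z + 2 * (form a z * form b z)) := by
  have hcs := form_sq_le_of_orthogonal h.form_add_self_neg h.form_add_right_eq_zero
    (h.form_perp_add_eq_zero z)
  rw [h.form_perp_self] at hcs
  simpa only [form_add_right, form_smul_right, h.orth_left, h.orth_right, mul_zero, add_zero]
    using hcs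

lemma neg_form_right_lt {n : Vec d} {s : ℝ} (hs : 0 < form (horocycle a b w s) n)
    (han : form a n ≤ 0) : -form b n < s * form w n := by
  rw [form_horocycle] at hs
  have hw := h.form_self_nonneg
  linarith [mul_nonpos_of_nonneg_of_nonpos (by positivity : 0 ≤ s ^ 2 * form w w / 2) han]

lemma sq_form_mul_sub_le {n : Vec d} (hn : form n n = 1) (han : form a n ≤ 0) (hbn : form b n ≤ 0)
    {k r : ℝ} (hk : 4 < k) (hr : 0 < r) (h₁ : 0 < form (horocycle a b w r) n)
    (h₂ : 0 < form (horocycle a b w (k * r)) n) :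
    form w n ^ 2 * (k - 4) ≤ k * form w w := by
  have hw := h.form_self_nonneg
  have hbound := mul_mul_le_two_mul_sq hr (mul_nonneg (neg_nonneg.mpr han) (by positivity))
    (neg_nonneg.mpr hbn) (neg_form_left_mul_lt (by positivity) h₂ hbn).le
    (h.neg_form_right_lt h₁ han).le
  have hbessel := mul_le_mul_of_nonneg_left (h.form_sq_le n) (by positivity : 0 ≤ k)
  rw [hn] at hbessel
  linarith

/-- If each of two half-spaces cuts a long arc `±[r, k r]` out of a horocycle, their
boundary hyperplanes are close to each other. -/
lemma neg_form_le {n m : Vec d} (hw : 0 < form w w) (hn : form n n = 1) (hm : form m m = 1)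
    (han : form a n ≤ 0) (ham : form a m ≤ 0) (hbn : form b n ≤ 0) (hbm : form b m ≤ 0)
    {k r : ℝ} (hk : 4 < k) (hr : 0 < r)
    (hn₁ : 0 < form (horocycle a b w r) n) (hn₂ : 0 < form (horocycle a b w (k * r)) n)
    (hm₁ : 0 < form (horocycle a b (-w) r) m) (hm₂ : 0 < form (horocycle a b (-w) (k * r)) m) :
    -form n m ≤ 1 + 8 / (k - 4) := by
  have hkr : 0 < k * r := by positivity
  have hsn := h.sq_form_mul_sub_le hn han hbn hk hr hn₁ hn₂
  have hsm := h.neg.sq_form_mul_sub_le hm ham hbm hk hr hm₁ hm₂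
  have hαn := neg_form_left_mul_lt hkr hn₂ hbn
  have hαm := neg_form_left_mul_lt hkr hm₂ hbm
  have hβn := h.neg_form_right_lt hn₁ han
  have hβm := h.neg.neg_form_right_lt hm₁ ham
  simp only [form_neg_left, form_neg_right, neg_neg] at hsm hαm hβm
  have hbound := mul_mul_le_two_mul_sq (α := -form a (n + m)) (β := -form b (n + m))
    (Ω := form w n - form w m) (k := k) (r := r) (ρ := form w w) hr
    (mul_nonneg (by rw [form_add_right]; linarith) (by positivity))
    (by rw [form_add_right]; linarith)
    (by rw [form_add_right]; linarith) (by rw [form_add_right]; linarith)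
  have hprod : form a (n + m) * form b (n + m) ≤ 8 / (k - 4) := by
    rw [le_div_iff₀ (by linarith)]
    refine le_of_mul_le_mul_right ?_ (by positivity : 0 < k * form w w)
    calc form a (n + m) * form b (n + m) * (k - 4) * (k * form w w)
        = (-form a (n + m) * -form b (n + m) * (k * form w w)) * (k - 4) := by ring
      _ ≤ 2 * (form w n - form w m) ^ 2 * (k - 4) :=
        mul_le_mul_of_nonneg_right hbound (by linarith)
      _ ≤ 4 * (form w n ^ 2 * (k - 4) + (-form w m) ^ 2 * (k - 4)) := by
        nlinarith [mul_nonneg (sq_nonneg (form w n + form w m)) (sub_pos.mpr hk).le]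
      _ ≤ 8 * (k * form w w) := by linarith
  have hsum := h.form_self_add_nonneg (n + m)
  rw [form_add_right (n + m), form_add_left, form_add_left, hn, hm, form_comm m n] at hsum
  linarith

end IsHorocyclicFrame

/-! ### Round balls with disjoint closures -/

section Balls

lemma form_self_add_sqrt_smul {v u : Vec d} (hv : form v v < 0) (hu : form u u = 1)
    (huv : form u v = 0) :
    form (v + √(-form v v) • u) (v + √(-form v v) • u) = 0 := by
  simp only [form_add_left, form_add_right, form_smul_left, form_smul_right, form_comm v u, huv,
    hu]
  linarith [Real.mul_self_sqrt (neg_pos.mpr hv).le]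

lemma ht_add_sqrt_smul_pos {v u : Vec d} (hv : form v v < 0) (hv0 : 0 < ht v)
    (hu : form u u = 1) (huv : form u v = 0) : 0 < ht (v + √(-form v v) • u) := by
  refine ht_pos_of_form_neg (form_self_add_sqrt_smul hv hu huv).le hv hv0 ?_
  rwa [form_add_left, form_smul_left, huv, mul_zero, add_zero]

lemma exists_timelike_orthogonal {y n : Vec d} (hy : form y y < 0) (hy0 : 0 < ht y)
    (hn : 0 < form n n) : ∃ y', form y' y' < 0 ∧ 0 < ht y' ∧ form y' n = 0 ∧
      ∀ z, form n z = 0 → form y' z = form y z := by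
  set y' := y - (form y n / form n n) • n with hy'
  have horth : form y' n = 0 := by
    rw [hy', form_sub_left, form_smul_left, div_mul_cancel₀ _ hn.ne', sub_self]
  have hyy' : form y' y = form y y - form y n ^ 2 / form n n := by
    rw [hy', form_sub_left, form_smul_left, form_comm n y]; ring
  have hself : form y' y' = form y' y := by
    rw [hy', form_sub_right, ← hy', form_smul_right, horth, mul_zero, sub_zero]
  have hsq : 0 ≤ form y n ^ 2 / form n n := by positivity
  refine ⟨y', by linarith, ht_pos_of_form_neg (by linarith) hy hy0 (by linarith), horth,
    fun z hz => ?_⟩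
  rw [hy', form_sub_left, form_smul_left, hz, mul_zero, sub_zero]

lemma exists_hyp_orthogonal {n : Vec d} (hn : 0 < form n n) : ∃ y : Hyp d, form y.1 n = 0 := by
  obtain ⟨y, hy, hy0, hyn, -⟩ :=
    exists_timelike_orthogonal (form_hyp_self_neg (o d)) (o d).2.2 hn
  exact ⟨normalize y hy hy0, by rw [normalize, form_smul_left, hyn, mul_zero]⟩

lemma exists_isHorocyclicFrame {ξ n : Vec d} (hξ : form ξ ξ = 0) (hξ0 : 0 < ht ξ)
    (hn : 0 < form n n) (hξn : form ξ n = 0) : ∃ a, IsHorocyclicFrame a ξ n := by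
  obtain ⟨y, hy⟩ := exists_hyp_orthogonal hn
  have hα := form_hyp_neg hξ.le hξ0 y
  set α := form ξ y.1 with hα_def
  set a := -(2 * α ^ 2)⁻¹ • ((2 * α) • y.1 + ξ) with ha
  have hnull : form a a = 0 := by
    simp only [ha, form_smul_left, form_smul_right, form_add_left, form_add_right, y.2.1, hξ,
      form_comm y.1 ξ, ← hα_def]
    ring
  refine ⟨a, hnull, hξ, ?_, ?_, by rw [form_comm, hξn], ?_, hξ0⟩
  · simp only [ha, form_smul_left, form_add_left, hξ, form_comm y.1 ξ, ← hα_def]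
    field_simp [hα.ne]
    ring
  · rw [form_comm, ha, form_smul_left, form_add_left, form_smul_left, hy, hξn]
    simp
  · refine ht_pos_of_form_neg hnull.le (form_hyp_self_neg y) y.2.2 ?_
    have hval : form a y.1 = (2 * α)⁻¹ := by
      simp only [ha, form_smul_left, form_add_left, y.2.1, ← hα_def]
      field_simp [hα.ne]
      ring
    rw [hval]
    exact inv_neg''.mpr (by linarith)

lemma mem_closure_roundBall {n ξ : Vec d} (hn : 0 < form n n) (hξ : ξ ∈ sphereInf d)
    (h : 0 ≤ form ξ n) : ξ ∈ closure (roundBall n) := by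
  rcases h.lt_or_eq with h | h
  · exact subset_closure ⟨hξ, h⟩
  obtain ⟨a, hframe⟩ :=
    exists_isHorocyclicFrame hξ.1 (ht_pos_of_mem_sphereInf hξ) hn h.symm
  have hlim : Tendsto (fun s => klein (horocycle a ξ n s)) (𝓝[>] 0) (𝓝 ξ) := by
    have hzero : horocycle a ξ n 0 = ξ := by simp [horocycle]
    have hcont : ContinuousAt (fun s => klein (horocycle a ξ n s)) 0 :=
      (continuousAt_klein (hframe.ht_horocycle_pos 0).ne').comp
        (continuous_horocycle a ξ n).continuousAt
    simpa only [ContinuousAt, hzero, klein_eq_self hξ.2] using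
      hcont.tendsto.mono_left nhdsWithin_le_nhds
  refine mem_closure_of_tendsto hlim (eventually_mem_nhdsWithin.mono fun s hs => ?_)
  have hs0 : 0 < s := hs
  have hht := hframe.ht_horocycle_pos s
  refine ⟨klein_mem_sphereInf (hframe.form_horocycle_self s) hht.ne', ?_⟩
  rw [form_klein_left, form_horocycle, ← h, form_comm a n, hframe.orth_left]
  have : 0 < s * form n n := mul_pos hs0 hn
  rw [mul_zero, add_zero, zero_add]
  positivity

section Disjoint

variable {n m : Vec d}

lemma form_neg_of_disjoint (hn : 0 < form n n) (hm : 0 < form m m)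
    (hdis : Disjoint (closure (roundBall n)) (closure (roundBall m))) {v : Vec d}
    (hv : form v v = 0) (hv0 : 0 < ht v) (hvn : 0 ≤ form v n) : form v m < 0 := by
  by_contra! hvm
  have hmem : ∀ {l : Vec d}, 0 < form l l → 0 ≤ form v l → klein v ∈ closure (roundBall l) :=
    fun hl hvl => mem_closure_roundBall hl (klein_mem_sphereInf hv hv0.ne')
      (by rw [form_klein_left]; exact mul_nonneg (inv_pos.mpr hv0).le hvl)
  exact disjoint_left.mp hdis (hmem hn hvn) (hmem hm hvm)

lemma form_neg_of_disjoint_of_orthogonal (hd : 2 ≤ d) (hn : 0 < form n n) (hm : 0 < form m m)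
    (hdis : Disjoint (closure (roundBall n)) (closure (roundBall m))) {y : Vec d}
    (hy : form y y < 0) (hy0 : 0 < ht y) (hyn : form y n = 0) : form y m < 0 := by
  obtain ⟨w, hw, hwy, hwn, hwm⟩ :
      ∃ w, form w w = 1 ∧ form w y = 0 ∧ form w n = 0 ∧ 0 ≤ form w m := by
    obtain ⟨w, hw, hwy, hwn⟩ := exists_unit_orthogonal hd hy n
    rcases le_total 0 (form w m) with hwm | hwm
    · exact ⟨w, hw, hwy, hwn, hwm⟩
    · refine ⟨-w, ?_, ?_, ?_, ?_⟩ <;>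
        simp only [form_neg_left, form_neg_right, neg_neg, neg_zero, neg_nonneg, hw, hwy, hwn, hwm]
  have hneg := form_neg_of_disjoint hn hm hdis (form_self_add_sqrt_smul hy hw hwy)
    (ht_add_sqrt_smul_pos hy hy0 hw hwy) (by rw [form_add_left, form_smul_left, hyn, hwn]; simp)
  rw [form_add_left, form_smul_left] at hneg
  linarith [mul_nonneg (Real.sqrt_nonneg (-form y y)) hwm]

lemma timelike_sub_smul_of_disjoint (hd : 2 ≤ d) (hn : form n n = 1) (hm : form m m = 1)
    (hdis : Disjoint (closure (roundBall n)) (closure (roundBall m))) :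
    form (m - form n m • n) (m - form n m • n) < 0 ∧ 0 < ht (m - form n m • n) := by
  have hn0 : 0 < form n n := by linarith
  have hm0 : 0 < form m m := by linarith
  set z := m - form n m • n with hz
  have hzn : form z n = 0 := by rw [hz, form_sub_left, form_smul_left, hn, form_comm m]; ring
  have hzm : form z m = form z z := by
    rw [hz, form_sub_right, ← hz, form_smul_right, hzn, mul_zero, sub_zero]
  have hyz : ∀ y, form y y < 0 → 0 < ht y → form y n = 0 → form y z < 0 := by
    intro y hy hy0 hyn
    rw [hz, form_sub_right, form_smul_right, hyn, mul_zero, sub_zero]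
    exact form_neg_of_disjoint_of_orthogonal hd hn0 hm0 hdis hy hy0 hyn
  obtain ⟨y, hyn⟩ := exists_hyp_orthogonal hn0
  have hzz : form z z ≤ 0 := by
    by_contra! hpos
    obtain ⟨y', hy', hy'0, hy'z, hproj⟩ :=
      exists_timelike_orthogonal (form_hyp_self_neg y) y.2.2 hpos
    exact (hyz y' hy' hy'0 ((hproj n hzn).trans hyn)).ne hy'z
  have hz0 : 0 < ht z := ht_pos_of_form_neg hzz (form_hyp_self_neg y) y.2.2
    (by rw [form_comm]; exact hyz y.1 (form_hyp_self_neg y) y.2.2 hyn)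
  refine ⟨hzz.lt_of_ne fun h => ?_, hz0⟩
  exact (form_neg_of_disjoint hn0 hm0 hdis h hz0 hzn.ge).ne (hzm.trans h)

lemma form_lt_neg_one_of_disjoint (hd : 2 ≤ d) (hn : form n n = 1) (hm : form m m = 1)
    (hdis : Disjoint (closure (roundBall n)) (closure (roundBall m))) : form n m < -1 := by
  obtain ⟨hz, hz0⟩ := timelike_sub_smul_of_disjoint hd hn hm hdis
  obtain ⟨hz', hz'0⟩ := timelike_sub_smul_of_disjoint hd hm hn hdis.symm
  have hprod := form_neg_of_ht_pos hz.le hz0 hz' hz'0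
  simp only [form_sub_left, form_sub_right, form_smul_left, form_smul_right, hn, hm,
    form_comm m n] at hz hprod
  have hsq : 0 < form n m ^ 2 - 1 := by linarith
  have hneg : form n m < 0 := by
    refine neg_of_mul_neg_left (b := form n m ^ 2 - 1) ?_ hsq.le
    linarith
  have habs : 1 < |form n m| := one_lt_sq_iff_one_lt_abs _ |>.mp (by linarith)
  linarith [abs_of_neg hneg]

end Disjoint

end Balls

/-! ### Geodesics orthogonal to a hyperplane -/

section Ray

/-- `n` is a unit normal vector at `p` of the hyperplane `n^⊥`. -/
structure IsUnitNormal (n : Vec d) (p : Hyp d) : Prop where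
  form_self : form n n = 1
  form_point : form p.1 n = 0

/-- The point at signed distance `s` from `p` on the geodesic orthogonal at `p` to the hyperplane
with unit normal `n`; positive `s` lead to the side where the product with `n` is negative. -/
def ray {n : Vec d} {p : Hyp d} (h : IsUnitNormal n p) (s : ℝ) : Hyp d :=
  ⟨Real.cosh s • p.1 - Real.sinh s • n, by
    have hself : form (Real.cosh s • p.1 - Real.sinh s • n)
        (Real.cosh s • p.1 - Real.sinh s • n) = -1 := by
      simp only [form_sub_left, form_sub_right, form_smul_left, form_smul_right,
        form_comm n p.1, h.form_self, h.form_point, p.2.1]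
      linear_combination -Real.cosh_sq s
    refine ⟨hself, ht_pos_of_form_neg (by rw [hself]; norm_num) (form_hyp_self_neg p) p.2.2 ?_⟩
    rw [form_sub_left, form_smul_left, form_smul_left, form_comm n, h.form_point, p.2.1]
    linarith [Real.cosh_pos s]⟩

variable {n : Vec d} {p : Hyp d} (h : IsUnitNormal n p)

lemma ray_zero : ray h 0 = p := Subtype.ext (by simp [ray])

lemma continuous_ray : Continuous (ray h) :=
  ((Real.continuous_cosh.smul continuous_const).sub
    (Real.continuous_sinh.smul continuous_const)).subtype_mk _

lemma hdist_ray (s t : ℝ) : hdist (ray h s) (ray h t) = |s - t| := by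
  refine hdist_eq_of_neg_form_eq_cosh ?_
  simp only [ray, form_sub_left, form_sub_right, form_smul_left, form_smul_right, form_comm n p.1,
    h.form_self, h.form_point, p.2.1, Real.cosh_sub]
  ring

lemma form_ray (s : ℝ) : form (ray h s).1 n = -Real.sinh s := by
  simp only [ray, form_sub_left, form_smul_left, h.form_self, h.form_point]
  ring

lemma le_hdist_ray {s : ℝ} (hs : 0 ≤ s) {z : Hyp d} (hz : 0 ≤ form z.1 n) :
    s ≤ hdist (ray h s) z := by
  rw [le_hdist_iff hs]
  simp only [ray, form_sub_left, form_smul_left, form_comm n z.1]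
  linarith [mul_le_mul_of_nonneg_left (one_le_neg_form p z) (Real.cosh_pos s).le,
    mul_nonneg (Real.sinh_nonneg_iff.mpr hs) hz]

lemma IsUnitNormal.reverse (D : ℝ) :
    IsUnitNormal (Real.sinh D • p.1 - Real.cosh D • n) (ray h D) := by
  constructor <;>
    simp only [ray, form_sub_left, form_sub_right, form_smul_left, form_smul_right,
      form_comm n p.1, h.form_self, h.form_point, p.2.1]
  · linear_combination Real.cosh_sq D
  · ring

lemma ray_reverse (D s : ℝ) : ray (h.reverse D) (D - s) = ray h s := by
  refine Subtype.ext ?_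
  simp only [ray, Real.cosh_sub, Real.sinh_sub]
  match_scalars
  · linear_combination Real.cosh s * Real.cosh_sq D
  · linear_combination -Real.sinh s * Real.cosh_sq D

lemma exists_perpendicular (hd : 2 ≤ d) {n m : Vec d} (hn : form n n = 1) (hm : form m m = 1)
    (hdis : Disjoint (closure (roundBall n)) (closure (roundBall m))) :
    ∃ D > 0, Real.cosh D = -form n m ∧ ∃ (p q : Hyp d) (hp : IsUnitNormal n p)
      (hq : IsUnitNormal m q), ∀ s, ray hp s = ray hq (D - s) := by
  have hc := form_lt_neg_one_of_disjoint hd hn hm hdis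
  obtain ⟨-, hz0⟩ := timelike_sub_smul_of_disjoint hd hn hm hdis
  obtain ⟨D, hD, hcosh⟩ : ∃ D > 0, Real.cosh D = -form n m :=
    ⟨Real.arcosh (-form n m), Real.arcosh_pos (by linarith), Real.cosh_arcosh (by linarith)⟩
  have hS := Real.sinh_pos_iff.mpr hD
  have hz : form (m - form n m • n) (m - form n m • n) = -Real.sinh D ^ 2 := by
    simp only [form_sub_left, form_sub_right, form_smul_left, form_smul_right, hn, hm,
      form_comm m n]
    rw [Real.sinh_sq, hcosh]; ring
  let p : Hyp d := ⟨(Real.sinh D)⁻¹ • (m - form n m • n), by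
    rw [form_smul_left, form_smul_right, hz]; field_simp, by
    rw [ht_smul]; positivity⟩
  have hp : IsUnitNormal n p := ⟨hn, by
    simp only [p, form_smul_left, form_sub_left, hn, form_comm m n, mul_one, sub_self, mul_zero]⟩
  have hmp : m = Real.sinh D • p.1 - Real.cosh D • n := by
    rw [hcosh, neg_smul, sub_neg_eq_add, smul_inv_smul₀ hS.ne', sub_add_cancel]
  refine ⟨D, hD, hcosh, p, ray hp D, hp, hmp ▸ hp.reverse D, fun s => ?_⟩
  rw [← ray_reverse hp D s]
  congr
  exact hmp.symm

end Ray

/-! ### The convex hull near a complementary ball -/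

section ComplementaryBall

/-- `roundBall n`, for the unit normal `n`, is a connected component of the complement of the limit
set: it misses the limit set, which contains its boundary sphere. -/
structure IsComplementaryBall (Γ : Subgroup (G d)) (n : Vec d) : Prop where
  form_self : form n n = 1
  form_nonpos : ∀ ξ ∈ limitSet Γ, form ξ n ≤ 0
  mem_limitSet : ∀ ξ ∈ sphereInf d, form ξ n = 0 → ξ ∈ limitSet Γ

variable {Γ : Subgroup (G d)} {n : Vec d}

lemma mem_hullCone_of_orthogonal (hd : 2 ≤ d) (hn : IsComplementaryBall Γ n) {v : Vec d}
    (hv : form v v < 0) (hv0 : 0 < ht v) (hvn : form v n = 0) : v ∈ hullCone Γ := by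
  have null_mem : ∀ {u}, form u u = 1 → form u v = 0 → form u n = 0 →
      v + √(-form v v) • u ∈ hullCone Γ := by
    intro u hu huv hun
    have hpos := ht_add_sqrt_smul_pos hv hv0 hu huv
    refine mem_hullCone_of_klein_mem_limitSet hpos (hn.mem_limitSet _
      (klein_mem_sphereInf (form_self_add_sqrt_smul hv hu huv) hpos.ne') ?_)
    rw [form_klein_left, form_add_left, form_smul_left, hvn, hun, mul_zero, add_zero, mul_zero]
  obtain ⟨u, hu, huv, hun⟩ := exists_unit_orthogonal hd hv n
  have hneg : v + √(-form v v) • -u ∈ hullCone Γ := by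
    refine null_mem ?_ ?_ ?_ <;>
      simp only [form_neg_left, form_neg_right, neg_neg, neg_zero, hu, huv, hun]
  have hmid : v = (1 / 2 : ℝ) • ((v + √(-form v v) • u) + (v + √(-form v v) • -u)) := by module
  rw [hmid]
  exact (hullCone Γ).smul_mem one_half_pos ((hullCone Γ).add_mem (null_mem hu huv hun) hneg)

lemma mem_hull_of_near_hyperplane (hd : 2 ≤ d) (hn : IsComplementaryBall Γ n) {q z : Hyp d}
    (hq : q ∈ hull Γ) (hqn : form q.1 n < 0) (hzn : form z.1 n < 0)
    (hlt : 2 * (form z.1 n * form z.1 q.1) < -form q.1 n) : z ∈ hull Γ := by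
  -- `z` is `l • q` plus a vector of the hyperplane `n^⊥`, which is timelike for small `l`
  set l := form z.1 n / form q.1 n with hl
  have hl0 : 0 < l := div_pos_of_neg_of_neg hzn hqn
  have hlzq : -(2 * l * form z.1 q.1) < 1 := by
    rw [hl, ← neg_div_neg_eq, mul_div_assoc', div_mul_eq_mul_div, ← neg_div,
      div_lt_one (neg_pos.mpr hqn)]
    linarith
  have horth : form (z.1 - l • q.1) n = 0 := by
    rw [form_sub_left, form_smul_left, hl, div_mul_cancel₀ _ hqn.ne, sub_self]
  have hself : form (z.1 - l • q.1) (z.1 - l • q.1) < 0 := by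
    simp only [form_sub_left, form_sub_right, form_smul_left, form_smul_right, z.2.1, q.2.1,
      form_comm q.1 z.1]
    linarith [mul_pos hl0 hl0]
  have hpos : 0 < ht (z.1 - l • q.1) := by
    refine ht_pos_of_form_neg hself.le (form_hyp_self_neg z) z.2.2 ?_
    rw [form_sub_left, form_smul_left, z.2.1, form_comm q.1]
    linarith
  rw [mem_hull_iff, ← sub_add_cancel z.1 (l • q.1)]
  exact (hullCone Γ).add_mem (mem_hullCone_of_orthogonal hd hn hself hpos horth)
    ((hullCone Γ).smul_mem hl0 (mem_hull_iff.mp hq))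

lemma continuous_form_hyp (v : Vec d) : Continuous fun z : Hyp d => form z.1 v :=
  continuous_form.comp (continuous_subtype_val.prodMk continuous_const)

lemma exists_forall_mem_interior_hull (hd : 2 ≤ d) (hn : IsComplementaryBall Γ n) {p q : Hyp d}
    (hp : form p.1 n = 0) (hq : q ∈ hull Γ) (hqn : form q.1 n < 0) :
    ∃ ε > 0, ∀ z : Hyp d, hdist z p < ε → form z.1 n < 0 → z ∈ interior (hull Γ) := by
  have hsmall : ∀ᶠ s in 𝓝 (0 : ℝ),
      2 * (Real.sinh s * Real.cosh (s + hdist p q)) < -form q.1 n :=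
    Continuous.tendsto (by fun_prop) 0 |>.eventually_lt_const (by simpa using hqn)
  obtain ⟨ε, hε, hball⟩ := Metric.eventually_nhds_iff.mp hsmall
  refine ⟨ε, hε, fun z hz hzn => ?_⟩
  have hopen : IsOpen {z : Hyp d | form z.1 n < 0 ∧
      2 * (form z.1 n * form z.1 q.1) < -form q.1 n} :=
    (isOpen_lt (continuous_form_hyp n) continuous_const).inter
      (isOpen_lt (continuous_const.mul ((continuous_form_hyp n).mul (continuous_form_hyp q.1)))
        continuous_const)
  refine mem_interior.mpr ⟨_, fun z hz => mem_hull_of_near_hyperplane hd hn hq hqn hz.1 hz.2,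
    hopen, hzn, ?_⟩
  have hdz := hdist_nonneg z p
  have hzn' : -form z.1 n ≤ Real.sinh (hdist z p) :=
    (neg_le_abs _).trans (abs_form_le_sinh_hdist hn.form_self hp z)
  have hzq : -form z.1 q.1 ≤ Real.cosh (hdist z p + hdist p q) :=
    (hdist_le_iff (add_nonneg hdz (hdist_nonneg p q))).mp (hdist_triangle z p q)
  calc 2 * (form z.1 n * form z.1 q.1) = 2 * (-form z.1 n * -form z.1 q.1) := by ring
    _ ≤ 2 * (Real.sinh (hdist z p) * Real.cosh (hdist z p + hdist p q)) := by
      have := one_le_neg_form z q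
      gcongr
    _ < -form q.1 n := hball (by rwa [Real.dist_0_eq_abs, abs_of_nonneg hdz])

lemma notMem_interior_hull (hn : IsComplementaryBall Γ n) {p : Hyp d} (hp : form p.1 n = 0) :
    p ∉ interior (hull Γ) := by
  intro hint
  have hray : IsUnitNormal n p := ⟨hn.form_self, hp⟩
  have hev : ∀ᶠ s in 𝓝 (0 : ℝ), ray hray s ∈ interior (hull Γ) :=
    (continuous_ray hray).continuousAt.eventually_mem
      (isOpen_interior.mem_nhds (by rwa [ray_zero]))
  obtain ⟨s, hs, hs0 : s < 0⟩ :=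
    ((hev.filter_mono nhdsWithin_le_nhds).and (self_mem_nhdsWithin (s := Iio 0))).exists
  have hle := form_nonpos_of_mem_hullCone hn.form_nonpos (mem_hull_iff.mp (interior_subset hs))
  rw [form_ray] at hle
  linarith [Real.sinh_neg_iff.mpr hs0]

end ComplementaryBall

/-! ### Proper discontinuity -/

section Proper

lemma isClosed_SOQ : IsClosed (SOQ d : Set (Matrix.SpecialLinearGroup (Idx d) ℝ)) := by
  have hcont (v : Vec d) : Continuous fun g : Matrix.SpecialLinearGroup (Idx d) ℝ => g.1.mulVec v :=
    continuous_subtype_val.matrix_mulVec continuous_const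
  have hinter : (SOQ d : Set (Matrix.SpecialLinearGroup (Idx d) ℝ)) =
      ⋂ (v : Vec d) (w : Vec d), {g | form (g.1.mulVec v) (g.1.mulVec w) = form v w} := by
    ext g
    simp only [mem_iInter]
    rfl
  rw [hinter]
  exact isClosed_iInter fun v => isClosed_iInter fun w =>
    isClosed_eq (continuous_form.comp ((hcont v).prodMk (hcont w))) continuous_const

lemma isClosedEmbedding_mat : IsClosedEmbedding (G.mat : G d → Matrix (Idx d) (Idx d) ℝ) :=
  (Matrix.SpecialLinearGroup.isClosedEmbedding_val.comp
    isClosed_SOQ.isClosedEmbedding_subtypeVal).comp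
    isClosed_connectedComponent.isClosedEmbedding_subtypeVal

lemma isCompact_setOf_abs_mat_le (C : ℝ) : IsCompact {g : G d | ∀ i j, |g.mat i j| ≤ C} := by
  have hbox : IsCompact (Set.pi univ fun _ : Idx d => Set.pi univ fun _ : Idx d => Icc (-C) C) :=
    isCompact_univ_pi fun _ => isCompact_univ_pi fun _ => isCompact_Icc
  convert isClosedEmbedding_mat.isCompact_preimage hbox using 1
  ext g
  exact ⟨fun h i _ j _ => abs_le.mp (h i j), fun h i j => abs_le.mpr (h i trivial j trivial)⟩

lemma sum_sq_eq_form_add (v : Vec d) :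
    ∑ i, v i ^ 2 = form v v + 2 * form v (o d).1 ^ 2 := by
  have hsqrt : (√2)⁻¹ ^ 2 = (2 : ℝ)⁻¹ := by rw [inv_pow, Real.sq_sqrt zero_le_two]
  have ho : form v (o d).1 = -(√2)⁻¹ * ht v := by
    simp only [form, o, ht, Sum.elim_inl, Sum.elim_inr, mul_zero, Finset.sum_const_zero]
    ring
  rw [ho, mul_pow, neg_sq, hsqrt]
  simp only [Fintype.sum_sum_type, Finset.univ_unique, Finset.sum_singleton, form, ht, sq,
    PUnit.default_eq_unit]
  ring

lemma sq_apply_le (v : Vec d) (i : Idx d) : v i ^ 2 ≤ form v v + 2 * form v (o d).1 ^ 2 := by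
  rw [← sum_sq_eq_form_add]
  exact Finset.single_le_sum (fun j _ => sq_nonneg (v j)) (Finset.mem_univ i)

lemma sq_form_single_le (v : Vec d) (i : Idx d) :
    form (Pi.single i 1) v ^ 2 ≤ form v v + 2 * form v (o d).1 ^ 2 := by
  rcases i with ⟨⟩ | i | ⟨⟩
  · simpa [form, Pi.single_apply] using sq_apply_le v (lstI d)
  · simpa [form, Pi.single_apply] using sq_apply_le v (midI i)
  · simpa [form, Pi.single_apply] using sq_apply_le v (fstI d)

lemma form_mulVec_left (g : G d) (v w : Vec d) :
    form (g.mat.mulVec v) w = form v (g⁻¹.mat.mulVec w) := by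
  rw [← form_mat g⁻¹, mulVec_inv_mulVec]

lemma abs_mat_le (g : G d) (i j : Idx d) :
    |g.mat i j| ≤ 2 * Real.cosh (hdist (o d) (g • o d)) := by
  have hgo : form (g⁻¹.mat.mulVec (o d).1) (o d).1 = -Real.cosh (hdist (o d) (g • o d)) := by
    rw [cosh_hdist, neg_neg, form_mulVec_left, inv_inv]; rfl
  have hcol : form (g.mat.mulVec (Pi.single j 1)) (o d).1 ^ 2 ≤
      -1 + 2 * Real.cosh (hdist (o d) (g • o d)) ^ 2 := by
    rw [form_mulVec_left]
    refine (sq_form_single_le _ j).trans_eq ?_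
    rw [form_mat, (o d).2.1, hgo, neg_sq]
  have hsingle : form (Pi.single j 1 : Vec d) (Pi.single j 1) ≤ 1 := by
    rcases j with ⟨⟩ | j | ⟨⟩ <;> simp [form, Pi.single_apply]
  have hentry := sq_apply_le (g.mat.mulVec (Pi.single j 1)) i
  have happ : g.mat.mulVec (Pi.single j 1) i = g.mat i j := by rw [Matrix.mulVec_single_one]; rfl
  rw [form_mat, happ] at hentry
  refine abs_le_of_sq_le_sq ?_ (by positivity)
  linarith

variable {Γ : Subgroup (G d)} [DiscreteTopology Γ]

lemma finite_setOf_hdist_smul_le (x : Hyp d) (R : ℝ) :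
    {γ : G d | γ ∈ Γ ∧ hdist x (γ • x) ≤ R}.Finite := by
  set C := 2 * Real.cosh (hdist (o d) x + R + hdist x (o d))
  have hcompact : IsCompact ((Γ : Set (G d)) ∩ {g : G d | ∀ i j, |g.mat i j| ≤ C}) :=
    (isCompact_setOf_abs_mat_le C).inter_left Subgroup.isClosed_of_discrete
  have hdiscrete : IsDiscrete ((Γ : Set (G d)) ∩ {g : G d | ∀ i j, |g.mat i j| ≤ C}) :=
    IsDiscrete.mono ⟨‹DiscreteTopology Γ›⟩ inter_subset_left
  refine (hcompact.finite hdiscrete).subset fun γ ⟨hγ, hR⟩ => ⟨hγ, fun i j => ?_⟩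
  have hle : hdist (o d) (γ • o d) ≤ hdist (o d) x + R + hdist x (o d) := by
    have hx := hdist_triangle (o d) x (γ • o d)
    have hγx := hdist_triangle x (γ • x) (γ • o d)
    rw [hdist_smul] at hγx
    linarith
  refine (abs_mat_le γ i j).trans (mul_le_mul_of_nonneg_left ?_ zero_le_two)
  exact Real.cosh_le_cosh.mpr (abs_le_abs_of_nonneg (hdist_nonneg _ _) hle)

lemma hdist_smul_pos (htf : ∀ γ ∈ Γ, IsOfFinOrder γ → γ = 1) {γ : G d} (hγ : γ ∈ Γ)
    (hne : γ ≠ 1) (x : Hyp d) : 0 < hdist x (γ • x) := by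
  refine (hdist_nonneg _ _).lt_of_ne fun h0 => hne (htf γ hγ ?_)
  have hfix : γ ∈ MulAction.stabilizer (G d) x := (eq_of_hdist_eq_zero h0.symm).symm
  refine finite_powers.mp ((finite_setOf_hdist_smul_le (Γ := Γ) x 0).subset ?_)
  rintro _ ⟨k, rfl⟩
  have hpow : γ ^ k • x = x := pow_mem hfix k
  exact ⟨pow_mem hγ k, by simp only [hpow, hdist_self, le_refl]⟩

lemma exists_forall_le_hdist_smul (htf : ∀ γ ∈ Γ, IsOfFinOrder γ → γ = 1) (x : Hyp d) :
    ∃ ε > 0, ∀ γ ∈ Γ, γ ≠ 1 → ε ≤ hdist x (γ • x) := by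
  have hnear : ∀ᶠ ε in 𝓝[>] (0 : ℝ), ∀ γ ∈ {γ : G d | γ ∈ Γ ∧ hdist x (γ • x) ≤ 1},
      γ ≠ 1 → ε ≤ hdist x (γ • x) := by
    refine (eventually_all_finite (finite_setOf_hdist_smul_le x 1)).mpr fun γ hγ => ?_
    by_cases hne : γ = 1
    · exact Eventually.of_forall fun ε h => absurd hne h
    · exact ((eventually_le_nhds (hdist_smul_pos htf hγ.1 hne x)).filter_mono
        nhdsWithin_le_nhds).mono fun ε h _ => h
  obtain ⟨ε, hε, hε1, hε0⟩ := (hnear.and (((eventually_le_nhds zero_lt_one).filter_mono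
    nhdsWithin_le_nhds).and self_mem_nhdsWithin)).exists
  refine ⟨ε, hε0, fun γ hγ hne => ?_⟩
  by_cases hle : hdist x (γ • x) ≤ 1
  · exact hε γ ⟨hγ, hle⟩ hne
  · exact hε1.trans (not_le.mp hle).le

end Proper

/-! ### The distance of the quotient and the core -/

section Quotient

variable {Γ : Subgroup (G d)}

lemma mk_eq_mk_iff {p q : Hyp d} : (⟦p⟧ : Mfd Γ) = ⟦q⟧ ↔ ∃ γ : Γ, γ • q = p := by
  rw [Quotient.eq]
  exact MulAction.orbitRel_apply

lemma mk_smul (γ : Γ) (p : Hyp d) : (⟦γ • p⟧ : Mfd Γ) = ⟦p⟧ := mk_eq_mk_iff.mpr ⟨γ, rfl⟩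

lemma mdist_mk_le (p q : Hyp d) : mdist (⟦p⟧ : Mfd Γ) ⟦q⟧ ≤ hdist p q :=
  csInf_le ⟨0, by rintro r ⟨p, q, -, -, rfl⟩; exact hdist_nonneg p q⟩ ⟨p, q, rfl, rfl, rfl⟩

lemma le_mdist {x y : Mfd Γ} {r : ℝ}
    (h : ∀ p q : Hyp d, (⟦p⟧ : Mfd Γ) = x → (⟦q⟧ : Mfd Γ) = y → r ≤ hdist p q) :
    r ≤ mdist x y := by
  obtain ⟨p, hp⟩ := Quotient.exists_rep x
  obtain ⟨q, hq⟩ := Quotient.exists_rep y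
  refine le_csInf ⟨_, p, q, hp, hq, rfl⟩ ?_
  rintro _ ⟨p, q, hp, hq, rfl⟩
  exact h p q hp hq

lemma mdist_nonneg (x y : Mfd Γ) : 0 ≤ mdist x y := le_mdist fun p q _ _ => hdist_nonneg p q

lemma mdist_comm (x y : Mfd Γ) : mdist x y = mdist y x := by
  have hle (x y : Mfd Γ) : mdist x y ≤ mdist y x := le_mdist fun p q hp hq => by
    rw [← hp, ← hq, hdist_comm]; exact mdist_mk_le q p
  exact (hle x y).antisymm (hle y x)

lemma mdist_self (x : Mfd Γ) : mdist x x = 0 := by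
  obtain ⟨p, rfl⟩ := Quotient.exists_rep x
  exact ((mdist_mk_le p p).trans (hdist_self p).le).antisymm (mdist_nonneg _ _)

lemma le_mdist_mk {p : Hyp d} {y : Mfd Γ} {r : ℝ}
    (h : ∀ q : Hyp d, (⟦q⟧ : Mfd Γ) = y → r ≤ hdist p q) : r ≤ mdist ⟦p⟧ y := by
  refine le_mdist fun p' q hp hq => ?_
  obtain ⟨γ, rfl⟩ := mk_eq_mk_iff.mp hp
  have hle := h (γ⁻¹ • q) (by rw [mk_smul, hq])
  rwa [← hdist_smul (γ : G d), ← Subgroup.smul_def, ← Subgroup.smul_def, smul_inv_smul] at hle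

lemma mdist_triangle (x y z : Mfd Γ) : mdist x z ≤ mdist x y + mdist y z := by
  obtain ⟨q, rfl⟩ := Quotient.exists_rep y
  rw [← sub_le_iff_le_add']
  refine le_mdist_mk fun r hr => ?_
  rw [sub_le_comm, mdist_comm x ⟦q⟧]
  refine le_mdist_mk fun p hp => ?_
  rw [← hr, ← hp, sub_le_iff_le_add, hdist_comm q p]
  exact (mdist_mk_le p r).trans (hdist_triangle p q r)

lemma exists_mdist_eq_hdist [DiscreteTopology Γ] (htf : ∀ γ ∈ Γ, IsOfFinOrder γ → γ = 1)
    (x : Hyp d) : ∃ ε > 0, ∀ p q : Hyp d, hdist x p < ε → hdist x q < ε →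
      mdist (⟦p⟧ : Mfd Γ) ⟦q⟧ = hdist p q := by
  obtain ⟨ε, hε, hinj⟩ := exists_forall_le_hdist_smul htf x
  refine ⟨ε / 4, by positivity, fun p q hp hq => (mdist_mk_le p q).antisymm ?_⟩
  refine le_mdist_mk fun q' hq' => ?_
  obtain ⟨γ, rfl⟩ := mk_eq_mk_iff.mp hq'
  by_cases hγ : (γ : G d) = 1
  · rw [Subgroup.smul_def, hγ, one_smul]
  · have hxγx := hinj γ γ.2 hγ
    have hxp := hdist_triangle x p (γ • x)
    have hpγq := hdist_triangle p (γ • q) (γ • x)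
    have hpq := hdist_triangle p x q
    rw [Subgroup.smul_def, Subgroup.smul_def, hdist_smul, hdist_comm q x] at hpγq
    rw [hdist_comm p x] at hpq
    simp only [Subgroup.smul_def] at *
    linarith

instance : ContinuousConstSMul Γ (Hyp d) :=
  ⟨fun γ => ((continuous_mulVec (γ : G d)).comp continuous_subtype_val).subtype_mk _⟩

lemma mk_mem_core_iff {x : Hyp d} : (⟦x⟧ : Mfd Γ) ∈ core Γ ↔ x ∈ hull Γ := by
  refine ⟨?_, fun h => ⟨x, h, rfl⟩⟩
  rintro ⟨y, hy, hyx⟩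
  obtain ⟨γ, rfl⟩ := mk_eq_mk_iff.mp hyx.symm
  exact smul_mem_hull γ hy

lemma mk_mem_interior_core_iff {x : Hyp d} :
    (⟦x⟧ : Mfd Γ) ∈ interior (core Γ) ↔ x ∈ interior (hull Γ) := by
  have hpre : (fun x : Hyp d => (⟦x⟧ : Mfd Γ)) ⁻¹' core Γ = hull Γ := by
    ext y; exact mk_mem_core_iff
  have hopen : IsOpenMap fun x : Hyp d => (⟦x⟧ : Mfd Γ) := isOpenMap_quotient_mk'_mul
  rw [← hpre, ← hopen.preimage_interior_eq_interior_preimage continuous_quotient_mk', mem_preimage]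

lemma mk_mem_coreBoundary {x : Hyp d} (hx : x ∈ hull Γ) (hx' : x ∉ interior (hull Γ)) :
    (⟦x⟧ : Mfd Γ) ∈ coreBoundary Γ :=
  ⟨subset_closure (mk_mem_core_iff.mpr hx), mk_mem_interior_core_iff.not.mpr hx'⟩

lemma eventually_le_mdist_coreBoundary (hd : 2 ≤ d) {n : Vec d} (hn : IsComplementaryBall Γ n)
    {p q : Hyp d} (hp : IsUnitNormal n p) (hq : q ∈ hull Γ) (hqn : form q.1 n < 0) :
    ∀ᶠ s in 𝓝 (0 : ℝ), ∀ z ∈ coreBoundary Γ, s ≤ mdist (⟦ray hp s⟧ : Mfd Γ) z := by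
  obtain ⟨ε, hε, hint⟩ := exists_forall_mem_interior_hull hd hn hp.form_point hq hqn
  filter_upwards [eventually_lt_nhds (half_pos hε)] with s hsε z hz
  rcases le_or_gt s 0 with hs | hs
  · exact hs.trans (mdist_nonneg _ _)
  refine le_mdist_mk ?_
  rintro z rfl
  rcases le_or_gt 0 (form z.1 n) with hzn | hzn
  · exact le_hdist_ray hp hs.le hzn
  · have hzp : ε ≤ hdist z p := by
      by_contra! hlt
      exact hz.2 (mk_mem_interior_core_iff.mpr (hint z hlt hzn))
    have htri := hdist_triangle z (ray hp s) p
    have hsp := hdist_ray hp s 0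
    rw [ray_zero, sub_zero, abs_of_pos hs] at hsp
    rw [hdist_comm]
    linarith

end Quotient

/-! ### Closed geodesics of the double -/

section Geodesic

/-- Along the filter `l` of times, the curve `c` realizes the distance `δ` at unit speed; for
`l = 𝓝 t` this is a geodesic near time `t`, for `l = 𝓝[≥] t` a geodesic that starts at time `t`. -/
def IsGeodesicAlong {X : Type*} (δ : X → X → ℝ) (c : ℝ → X) (l : Filter ℝ) : Prop :=
  ∀ᶠ p in l ×ˢ l, δ (c p.1) (c p.2) = |p.1 - p.2|

namespace IsGeodesicAlong

variable {X : Type*} {δ : X → X → ℝ} {c c' : ℝ → X} {l l' : Filter ℝ}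

lemma mono (h : IsGeodesicAlong δ c l) (hl : l' ≤ l) : IsGeodesicAlong δ c l' :=
  h.filter_mono (prod_mono hl hl)

lemma congr (h : IsGeodesicAlong δ c l) (hc : c =ᶠ[l] c') : IsGeodesicAlong δ c' l := by
  filter_upwards [h, hc.prod_mk hc] with p hp hcp
  rw [← hcp.1, ← hcp.2, hp]

lemma comp (h : IsGeodesicAlong δ c l') {f : ℝ → ℝ} (hf : Tendsto f l l')
    (hiso : ∀ᶠ p in l ×ˢ l, |f p.1 - f p.2| = |p.1 - p.2|) :
    IsGeodesicAlong δ (fun s => c (f s)) l := by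
  filter_upwards [(hf.prodMap hf).eventually h, hiso] with p hp hfp
  exact hp.trans hfp

lemma exists_forall_mem_Ioo {t : ℝ} (h : IsGeodesicAlong δ c (𝓝 t)) :
    ∃ ε > 0, ∀ s ∈ Ioo (t - ε) (t + ε), ∀ s' ∈ Ioo (t - ε) (t + ε), δ (c s) (c s') = |s - s'| := by
  obtain ⟨ε, hε, hball⟩ := (nhds_basis_Ioo_pos t).prod_self.eventually_iff.mp h
  exact ⟨ε, hε, fun s hs s' hs' => hball (mk_mem_prod hs hs')⟩

end IsGeodesicAlong

end Geodesic

section Double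

variable {Γ : Subgroup (G d)}

lemma double_mk_eq {x y : core Γ} {i j : Bool} (h : (⟦(x, i)⟧ : Double Γ) = ⟦(y, j)⟧) :
    x = y ∧ (i = j ∨ x.1 ∈ coreBoundary Γ) := Quotient.exact h

/-- The set of lengths whose infimum is the gluing metric `ddist`. -/
def gluedLengths (a b : Double Γ) : Set ℝ :=
  {r | ∃ (x y : core Γ) (i : Bool), (⟦(x, i)⟧ : Double Γ) = a ∧ (⟦(y, i)⟧ : Double Γ) = b ∧
      r = mdist x.1 y.1} ∪
    {r | ∃ (x y z : core Γ) (i j : Bool), (⟦(x, i)⟧ : Double Γ) = a ∧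
      (⟦(y, j)⟧ : Double Γ) = b ∧ z.1 ∈ coreBoundary Γ ∧ r = mdist x.1 z.1 + mdist z.1 y.1}

lemma ddist_le_of_mem {a b : Double Γ} {r : ℝ} (hr : r ∈ gluedLengths a b) : ddist a b ≤ r := by
  refine csInf_le ⟨0, ?_⟩ hr
  rintro r (⟨x, y, i, -, -, rfl⟩ | ⟨x, y, z, i, j, -, -, -, rfl⟩)
  · exact mdist_nonneg _ _
  · exact add_nonneg (mdist_nonneg _ _) (mdist_nonneg _ _)

lemma ddist_same_copy (x y : core Γ) (i : Bool) :
    ddist (⟦(x, i)⟧ : Double Γ) ⟦(y, i)⟧ = mdist x.1 y.1 := by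
  have hmem : mdist x.1 y.1 ∈ gluedLengths (⟦(x, i)⟧ : Double Γ) ⟦(y, i)⟧ :=
    Or.inl ⟨x, y, i, rfl, rfl, rfl⟩
  refine (ddist_le_of_mem hmem).antisymm (le_csInf ⟨_, hmem⟩ ?_)
  rintro r (⟨x', y', i, hx, hy, rfl⟩ | ⟨x', y', z, i, j, hx, hy, -, rfl⟩)
  · rw [(double_mk_eq hx).1, (double_mk_eq hy).1]
  · rw [(double_mk_eq hx).1, (double_mk_eq hy).1]
    exact mdist_triangle _ _ _

lemma ddist_le_via (x y : core Γ) {z : core Γ} (hz : z.1 ∈ coreBoundary Γ) (i j : Bool) :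
    ddist (⟦(x, i)⟧ : Double Γ) ⟦(y, j)⟧ ≤ mdist x.1 z.1 + mdist z.1 y.1 :=
  ddist_le_of_mem (Or.inr ⟨x, y, z, i, j, rfl, rfl, hz, rfl⟩)

lemma add_le_ddist_of_ne {x y z₀ : core Γ} (hz₀ : z₀.1 ∈ coreBoundary Γ) {i j : Bool} (hij : i ≠ j)
    {r s : ℝ} (hr : ∀ z ∈ coreBoundary Γ, r ≤ mdist x.1 z)
    (hs : ∀ z ∈ coreBoundary Γ, s ≤ mdist y.1 z) :
    r + s ≤ ddist (⟦(x, i)⟧ : Double Γ) ⟦(y, j)⟧ := by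
  have via_boundary : ∀ z ∈ coreBoundary Γ, r + s ≤ mdist x.1 z + mdist z y.1 := by
    intro z hz
    rw [mdist_comm z]
    exact add_le_add (hr z hz) (hs z hz)
  refine le_csInf ⟨_, Or.inr ⟨x, y, z₀, i, j, rfl, rfl, hz₀, rfl⟩⟩ ?_
  rintro t (⟨x', y', k, hx, hy, rfl⟩ | ⟨x', y', z, k, l, hx, hy, hz, rfl⟩)
  · obtain ⟨rfl, rfl | hx'⟩ := double_mk_eq hx
    · obtain ⟨rfl, rfl | hy'⟩ := double_mk_eq hy
      · exact absurd rfl hij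
      · simpa only [mdist_self, add_zero] using via_boundary y' hy'
    · obtain ⟨rfl, -⟩ := double_mk_eq hy
      simpa only [mdist_self, zero_add] using via_boundary x' hx'
  · obtain ⟨rfl, -⟩ := double_mk_eq hx
    obtain ⟨rfl, -⟩ := double_mk_eq hy
    exact via_boundary z hz

/-- The arc `β` of the core followed in the copy `b` for times `t ≥ 0`, and its mirror image in the
other copy for `t < 0`. -/
def reflected (β : ℝ → core Γ) (b : Bool) (t : ℝ) : Double Γ :=
  ⟦(β |t|, if 0 ≤ t then b else !b)⟧

lemma ddist_same_copy_reflected (β : ℝ → core Γ) (b : Bool) {s t : ℝ} (h : 0 ≤ s ↔ 0 ≤ t) :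
    ddist (reflected β b s) (reflected β b t) = mdist (β |s|).1 (β |t|).1 := by
  simp only [reflected, h, ddist_same_copy]

lemma abs_abs_sub_abs_of_same_sign {s t : ℝ} (h : 0 ≤ s ↔ 0 ≤ t) : |(|s| - |t|)| = |s - t| := by
  by_cases hs : 0 ≤ s
  · rw [abs_of_nonneg hs, abs_of_nonneg (h.mp hs)]
  · rw [abs_of_neg (not_le.mp hs), abs_of_neg (not_le.mp (h.not.mp hs)), neg_sub_neg, abs_sub_comm]

lemma isGeodesicAlong_reflected_zero {β : ℝ → core Γ}
    (hβ : IsGeodesicAlong mdist (fun s => (β s).1) (𝓝[≥] 0)) (h0 : (β 0).1 ∈ coreBoundary Γ)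
    (hbdry : ∀ᶠ s in 𝓝[≥] 0, ∀ z ∈ coreBoundary Γ, s ≤ mdist (β s).1 z) (b : Bool) :
    IsGeodesicAlong ddist (reflected β b) (𝓝 0) := by
  have habs : Tendsto (fun s : ℝ => |s|) (𝓝 0) (𝓝[≥] 0) :=
    tendsto_nhdsWithin_iff.mpr ⟨continuous_abs.tendsto' 0 0 abs_zero,
      Eventually.of_forall fun s => abs_nonneg s⟩
  have hstart : ∀ᶠ s in 𝓝[≥] (0 : ℝ), mdist (β s).1 (β 0).1 = |s| := by
    have hconst : Tendsto (fun _ : ℝ => (0 : ℝ)) (𝓝[≥] 0) (𝓝[≥] 0) :=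
      tendsto_nhdsWithin_iff.mpr ⟨tendsto_const_nhds, Eventually.of_forall fun _ => self_mem_Ici⟩
    filter_upwards [(tendsto_id.prodMk hconst : Tendsto (fun s : ℝ => (s, (0 : ℝ))) _ _).eventually
      hβ] with s hs
    rwa [sub_zero] at hs
  have hstart := habs.eventually hstart
  have hbdry := habs.eventually hbdry
  filter_upwards [(habs.prodMap habs).eventually hβ, hstart.prod_mk hstart, hbdry.prod_mk hbdry]
    with ⟨s, t⟩ hst ⟨hs0, ht0⟩ ⟨hsb, htb⟩
  by_cases hsign : 0 ≤ s ↔ 0 ≤ t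
  · rw [ddist_same_copy_reflected β b hsign, ← abs_abs_sub_abs_of_same_sign hsign]
    exact hst
  · have hcopy : (if 0 ≤ s then b else !b) ≠ if 0 ≤ t then b else !b := by
      split_ifs <;> simp_all
    have hopp : |s| + |t| = |s - t| := by
      grind
    refine le_antisymm ((ddist_le_via _ _ h0 _ _).trans_eq ?_)
      (hopp ▸ add_le_ddist_of_ne h0 hcopy hsb htb)
    rw [hs0, mdist_comm, ht0, abs_abs, abs_abs, hopp]

lemma isGeodesicAlong_reflected {β : ℝ → core Γ} {t : ℝ} (ht : t ≠ 0)
    (hβ : IsGeodesicAlong mdist (fun s => (β s).1) (𝓝 |t|)) (b : Bool) :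
    IsGeodesicAlong ddist (reflected β b) (𝓝 t) := by
  have hsign : ∀ᶠ s in 𝓝 t, 0 ≤ s ↔ 0 ≤ t := by
    rcases ht.lt_or_gt with ht | ht
    · filter_upwards [eventually_lt_nhds ht] with s hs using by simp [hs.not_ge, ht.not_ge]
    · filter_upwards [eventually_gt_nhds ht] with s hs using by simp [hs.le, ht.le]
  filter_upwards [(hβ.comp (continuous_abs.tendsto t) ((hsign.prod_mk hsign).mono
    fun p hp => abs_abs_sub_abs_of_same_sign (hp.1.trans hp.2.symm))), hsign.prod_mk hsign]
    with p hp hpsign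
  rw [ddist_same_copy_reflected β b (hpsign.1.trans hpsign.2.symm), hp]

/-- The closed curve of length `2 * D` that follows the arc `β` on `[0, D]` in one copy and comes
back in the other copy. -/
def doubledArc {D : ℝ} (hD : 0 < D) (β : ℝ → core Γ) (t : ℝ) : Double Γ :=
  reflected β true (toIcoMod (mul_pos two_pos hD) (-D) t)

section DoubledArc

variable {D : ℝ} (hD : 0 < D) (β : ℝ → core Γ)

lemma doubledArc_add (t : ℝ) : doubledArc hD β (t + 2 * D) = doubledArc hD β t := by
  rw [doubledArc, doubledArc, toIcoMod_add_right]

lemma doubledArc_eq_reflected {t : ℝ} (ht : t ∈ Ico (-D) D) :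
    doubledArc hD β t = reflected β true t := by
  rw [doubledArc, (toIcoMod_eq_self _).mpr ⟨ht.1, by linarith [ht.2]⟩]

lemma doubledArc_eq_reflected_reverse {t : ℝ} (ht : t + D ∈ Ioo (-D) D) :
    doubledArc hD β t = reflected (fun s => β (D - s)) false (t + D) := by
  obtain ⟨htl, htr⟩ := ht
  rcases le_or_gt 0 (t + D) with h | h
  · rw [doubledArc_eq_reflected hD β ⟨by linarith, by linarith⟩, reflected, reflected,
      if_neg (by linarith), if_pos h, abs_of_neg (by linarith), abs_of_nonneg h]
    simp
  · rw [← doubledArc_add, doubledArc_eq_reflected hD β ⟨by linarith, by linarith⟩, reflected,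
      reflected, if_pos (by linarith), if_neg h.not_ge, abs_of_nonneg (by linarith), abs_of_neg h]
    ring_nf
    simp

lemma isGeodesicAlong_doubledArc_of_mem_Ico
    (hβ : ∀ t ∈ Icc 0 D, IsGeodesicAlong mdist (fun s => (β s).1) (𝓝[Icc 0 D] t))
    (hβ₀ : (β 0).1 ∈ coreBoundary Γ) (hβD : (β D).1 ∈ coreBoundary Γ)
    (hbdry₀ : ∀ᶠ s in 𝓝[≥] 0, ∀ z ∈ coreBoundary Γ, s ≤ mdist (β s).1 z)
    (hbdryD : ∀ᶠ s in 𝓝[≥] 0, ∀ z ∈ coreBoundary Γ, s ≤ mdist (β (D - s)).1 z) {t : ℝ}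
    (ht : t ∈ Ico (-D) D) : IsGeodesicAlong ddist (doubledArc hD β) (𝓝 t) := by
  rcases ht.1.eq_or_lt with rfl | htD
  · have hrev : IsGeodesicAlong mdist (fun s => (β (D - s)).1) (𝓝[≥] 0) := by
      refine (hβ D ⟨hD.le, le_rfl⟩).comp ?_ (Eventually.of_forall fun p => ?_)
      · rw [nhdsWithin_Icc_eq_nhdsLE hD]
        refine tendsto_nhdsWithin_iff.mpr ⟨?_, ?_⟩
        · exact ((continuous_const.sub continuous_id).tendsto' 0 D (sub_zero D)).mono_left
            nhdsWithin_le_nhds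
        · filter_upwards [self_mem_nhdsWithin] with s hs using sub_le_self D hs
      · rw [sub_sub_sub_cancel_left, abs_sub_comm]
    have hzero := isGeodesicAlong_reflected_zero hrev (by rwa [sub_zero]) hbdryD false
    have hshift : Tendsto (fun s => s + D) (𝓝 (-D)) (𝓝 0) :=
      (continuous_add_const D).tendsto' _ _ (neg_add_cancel D)
    refine (hzero.comp hshift (Eventually.of_forall fun p => ?_)).congr ?_
    · rw [add_sub_add_right_eq_sub]
    · filter_upwards [hshift.eventually (Ioo_mem_nhds (neg_neg_of_pos hD) hD)] with s hs
      exact (doubledArc_eq_reflected_reverse hD β hs).symm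
  · refine IsGeodesicAlong.congr (c := reflected β true) ?_ ?_
    · rcases eq_or_ne t 0 with rfl | ht0
      · refine isGeodesicAlong_reflected_zero ?_ hβ₀ hbdry₀ true
        simpa only [nhdsWithin_Icc_eq_nhdsGE hD] using hβ 0 ⟨le_rfl, hD.le⟩
      · have habs : |t| < D := abs_lt.mpr ⟨htD, ht.2⟩
        refine isGeodesicAlong_reflected ht0 ?_ true
        simpa only [nhdsWithin_eq_nhds.mpr (Icc_mem_nhds (abs_pos.mpr ht0) habs)] using
          hβ |t| ⟨abs_nonneg t, habs.le⟩
    · filter_upwards [Ioo_mem_nhds htD ht.2] with s hs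
      exact (doubledArc_eq_reflected hD β ⟨hs.1.le, hs.2⟩).symm

end DoubledArc

lemma hasClosedGeodesic_of_arc {D : ℝ} (hD : 0 < D) {β : ℝ → core Γ}
    (hβ : ∀ t ∈ Icc 0 D, IsGeodesicAlong mdist (fun s => (β s).1) (𝓝[Icc 0 D] t))
    (hβ₀ : (β 0).1 ∈ coreBoundary Γ) (hβD : (β D).1 ∈ coreBoundary Γ)
    (hbdry₀ : ∀ᶠ s in 𝓝[≥] 0, ∀ z ∈ coreBoundary Γ, s ≤ mdist (β s).1 z)
    (hbdryD : ∀ᶠ s in 𝓝[≥] 0, ∀ z ∈ coreBoundary Γ, s ≤ mdist (β (D - s)).1 z) :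
    HasClosedGeodesic Γ (2 * D) := by
  have hp : 0 < 2 * D := mul_pos two_pos hD
  refine ⟨hp, doubledArc hD β, doubledArc_add hD β, fun t => ?_⟩
  refine IsGeodesicAlong.exists_forall_mem_Ioo ?_
  set k := toIcoDiv hp (-D) t
  have hmem : t - k • (2 * D) ∈ Ico (-D) D :=
    ⟨left_le_toIcoMod hp _ _, (toIcoMod_lt_right hp (-D) t).trans_eq (by ring)⟩
  have hshift : doubledArc hD β = fun s => doubledArc hD β (s - k • (2 * D)) := by
    ext s
    rw [doubledArc, doubledArc, toIcoMod_sub_zsmul]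
  rw [hshift]
  refine (isGeodesicAlong_doubledArc_of_mem_Ico hD β hβ hβ₀ hβD hbdry₀ hbdryD hmem).comp
    ((continuous_sub_right _).tendsto t) (Eventually.of_forall fun p => ?_)
  rw [sub_sub_sub_cancel_right]

lemma ray_mem_hull {p : Hyp d} {n : Vec d} (hp : IsUnitNormal n p) {D : ℝ} (hpH : p ∈ hull Γ)
    (hD : ray hp D ∈ hull Γ) {s : ℝ} (hs : s ∈ Icc 0 D) : ray hp s ∈ hull Γ := by
  rcases hs.1.eq_or_lt with rfl | hs0
  · rwa [ray_zero]
  rcases hs.2.eq_or_lt with rfl | hsD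
  · exact hD
  have hcomb : (Real.sinh D)⁻¹ • (Real.sinh (D - s) • p.1 + Real.sinh s • (ray hp D).1) =
      (ray hp s).1 := by
    have := Real.sinh_pos_iff.mpr (hs0.trans hsD)
    simp only [ray, Real.sinh_sub]
    match_scalars <;> field_simp
    ring
  rw [mem_hull_iff, ← hcomb]
  exact (hullCone Γ).smul_mem (inv_pos.mpr (Real.sinh_pos_iff.mpr (hs0.trans hsD)))
    ((hullCone Γ).add_mem
      ((hullCone Γ).smul_mem (Real.sinh_pos_iff.mpr (sub_pos.mpr hsD)) (mem_hull_iff.mp hpH))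
      ((hullCone Γ).smul_mem (Real.sinh_pos_iff.mpr hs0) (mem_hull_iff.mp hD)))

lemma isGeodesicAlong_ray [DiscreteTopology Γ] (htf : ∀ γ ∈ Γ, IsOfFinOrder γ → γ = 1)
    {p : Hyp d} {n : Vec d} (hp : IsUnitNormal n p) (t : ℝ) :
    IsGeodesicAlong mdist (fun s => (⟦ray hp s⟧ : Mfd Γ)) (𝓝 t) := by
  obtain ⟨ε, hε, hloc⟩ := exists_mdist_eq_hdist htf (ray hp t)
  have hnear : ∀ᶠ s in 𝓝 t, hdist (ray hp t) (ray hp s) < ε := by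
    filter_upwards [Metric.ball_mem_nhds t hε] with s hs
    rwa [hdist_ray, abs_sub_comm]
  filter_upwards [hnear.prod_mk hnear] with q hq
  rw [hloc _ _ hq.1 hq.2, hdist_ray]

lemma hasClosedGeodesic_of_perpendicular (hd : 2 ≤ d) [DiscreteTopology Γ]
    (htf : ∀ γ ∈ Γ, IsOfFinOrder γ → γ = 1) {n m : Vec d} (hn : IsComplementaryBall Γ n)
    (hm : IsComplementaryBall Γ m) {p q : Hyp d} (hp : IsUnitNormal n p) (hq : IsUnitNormal m q)
    {D : ℝ} (hD : 0 < D) (hpq : ∀ s, ray hp s = ray hq (D - s)) :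
    HasClosedGeodesic Γ (2 * D) := by
  have hpD : ray hp D = q := by rw [hpq, sub_self, ray_zero]
  have hqD : ray hq D = p := by rw [← ray_zero hp, hpq, sub_zero]
  have hpH : p ∈ hull Γ := mem_hull_iff.mpr
    (mem_hullCone_of_orthogonal hd hn (form_hyp_self_neg p) p.2.2 hp.form_point)
  have hqH : q ∈ hull Γ := mem_hull_iff.mpr
    (mem_hullCone_of_orthogonal hd hm (form_hyp_self_neg q) q.2.2 hq.form_point)
  have hsinh := Real.sinh_pos_iff.mpr hD
  have hqn : form q.1 n < 0 := by rw [← hpD, form_ray]; linarith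
  have hpm : form p.1 m < 0 := by rw [← hqD, form_ray]; linarith
  let β : ℝ → core Γ := IccExtend hD.le fun s =>
    ⟨⟦ray hp s⟧, mk_mem_core_iff.mpr (ray_mem_hull hp hpH (by rwa [hpD]) s.2)⟩
  have hβ : ∀ s ∈ Icc 0 D, (β s).1 = ⟦ray hp s⟧ := fun s hs => by
    simp only [β, IccExtend_of_mem hD.le _ hs]
  have hIcc : ∀ᶠ s in 𝓝[≥] (0 : ℝ), s ∈ Icc 0 D := Icc_mem_nhdsGE hD
  refine hasClosedGeodesic_of_arc hD (β := β) (fun t _ => ?_) ?_ ?_ ?_ ?_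
  · refine ((isGeodesicAlong_ray htf hp t).mono nhdsWithin_le_nhds).congr ?_
    filter_upwards [self_mem_nhdsWithin] with s hs using (hβ s hs).symm
  · rw [hβ 0 ⟨le_rfl, hD.le⟩, ray_zero]
    exact mk_mem_coreBoundary hpH (notMem_interior_hull hn hp.form_point)
  · rw [hβ D ⟨hD.le, le_rfl⟩, hpD]
    exact mk_mem_coreBoundary hqH (notMem_interior_hull hm hq.form_point)
  · filter_upwards [(eventually_le_mdist_coreBoundary hd hn hp hqH hqn).filter_mono
      nhdsWithin_le_nhds, hIcc] with s hs hsD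
    rwa [hβ s hsD]
  · filter_upwards [(eventually_le_mdist_coreBoundary hd hm hq hpH hpm).filter_mono
      nhdsWithin_le_nhds, hIcc] with s hs hsD
    rwa [hβ (D - s) ⟨by linarith [hsD.2], by linarith [hsD.1]⟩, hpq, sub_sub_cancel]

lemma cosh_half_systole_le (hd : 2 ≤ d) [DiscreteTopology Γ]
    (htf : ∀ γ ∈ Γ, IsOfFinOrder γ → γ = 1) {η : ℝ} (hη : 0 < η)
    (hsys : η ∈ lowerBounds {ℓ | HasClosedGeodesic Γ ℓ}) {n m : Vec d}
    (hn : IsComplementaryBall Γ n) (hm : IsComplementaryBall Γ m)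
    (hdis : Disjoint (closure (roundBall n)) (closure (roundBall m))) :
    Real.cosh (η / 2) ≤ -form n m := by
  obtain ⟨D, hD, hcosh, p, q, hp, hq, hpq⟩ :=
    exists_perpendicular hd hn.form_self hm.form_self hdis
  have hle : η ≤ 2 * D := hsys (hasClosedGeodesic_of_perpendicular hd htf hn hm hp hq hD hpq)
  rw [← hcosh, Real.cosh_le_cosh, abs_of_pos hD, abs_of_pos (half_pos hη)]
  linarith

end Double

/-! ### Visits of horocycles to the limit set -/

lemma exists_subset_of_isPreconnected {X ι : Type*} [TopologicalSpace X] {U : ι → Set X}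
    (hU : ∀ i, IsOpen (U i)) (hdis : Pairwise fun i j => Disjoint (U i) (U j)) {S : Set X}
    (hS : IsPreconnected S) (hne : S.Nonempty) (hcov : S ⊆ ⋃ i, U i) : ∃ i, S ⊆ U i := by
  obtain ⟨x, hx⟩ := hne
  obtain ⟨i, hi⟩ := mem_iUnion.mp (hcov hx)
  refine ⟨i, hS.subset_left_of_subset_union (hU i)
    (isOpen_iUnion fun j => isOpen_iUnion fun _ : j ≠ i => hU j) ?_ ?_ ⟨x, hx, hi⟩⟩
  · exact disjoint_iUnion₂_right.mpr fun j hj => hdis hj.symm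
  · intro y hy
    obtain ⟨j, hj⟩ := mem_iUnion.mp (hcov hy)
    by_cases hji : j = i
    · exact Or.inl (hji ▸ hj)
    · exact Or.inr (mem_iUnion₂.mpr ⟨j, hji, hj⟩)

/-- The round balls cut out by the unit vectors `n i` are the components of the complement of the
limit set, and their closures are disjoint. -/
structure IsBallDecomposition {ι : Type*} (Γ : Subgroup (G d)) (n : ι → Vec d) : Prop where
  form_self : ∀ i, form (n i) (n i) = 1
  iUnion_eq : sphereInf d \ limitSet Γ = ⋃ i, roundBall (n i)
  disjoint : Pairwise fun i j => Disjoint (closure (roundBall (n i))) (closure (roundBall (n j)))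

variable {ι : Type*} {Γ : Subgroup (G d)} {n : ι → Vec d} {a b w : Vec d}

lemma IsBallDecomposition.isComplementaryBall (hn : IsBallDecomposition Γ n) (i : ι) :
    IsComplementaryBall Γ (n i) where
  form_self := hn.form_self i
  form_nonpos ξ hξ := by
    by_contra! hpos
    have hmem : ξ ∈ sphereInf d \ limitSet Γ :=
      hn.iUnion_eq ▸ mem_iUnion.mpr ⟨i, hξ.1, hpos⟩
    exact hmem.2 hξ
  mem_limitSet ξ hξ h0 := by
    by_contra hξΛ
    obtain ⟨j, hj⟩ := mem_iUnion.mp (hn.iUnion_eq ▸ mem_sdiff_of_mem hξ hξΛ)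
    have hij : i ≠ j := by
      rintro rfl
      exact hj.2.ne' h0
    exact disjoint_left.mp (hn.disjoint hij)
      (mem_closure_roundBall (by rw [hn.form_self]; exact one_pos) hξ h0.ge) (subset_closure hj)

lemma IsComplementaryBall.form_nonpos_of_klein_mem {n v : Vec d} (hn : IsComplementaryBall Γ n)
    (hv0 : 0 < ht v) (hv : klein v ∈ limitSet Γ) : form v n ≤ 0 :=
  form_nonpos_of_mem_hullCone hn.form_nonpos (mem_hullCone_of_klein_mem_limitSet hv0 hv)

lemma klein_mem_roundBall_iff {n v : Vec d} (hv : form v v = 0) (hv0 : 0 < ht v) :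
    klein v ∈ roundBall n ↔ 0 < form v n := by
  rw [roundBall, mem_ofPred_eq, form_klein_left, mul_pos_iff_of_pos_left (inv_pos.mpr hv0)]
  exact and_iff_right (klein_mem_sphereInf hv hv0.ne')

lemma IsHorocyclicFrame.continuous_klein_horocycle (h : IsHorocyclicFrame a b w) :
    Continuous fun s => klein (horocycle a b w s) :=
  continuous_iff_continuousAt.mpr fun s => (continuousAt_klein (h.ht_horocycle_pos s).ne').comp
    (f := horocycle a b w) (continuous_horocycle a b w).continuousAt

lemma exists_forall_form_horocycle_pos (hn : IsBallDecomposition Γ n)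
    (h : IsHorocyclicFrame a b w) {S : Set ℝ} (hS : IsPreconnected S) (hne : S.Nonempty)
    (hΛ : ∀ s ∈ S, klein (horocycle a b w s) ∉ limitSet Γ) :
    ∃ i, ∀ s ∈ S, 0 < form (horocycle a b w s) (n i) := by
  have mem_ball : ∀ s i,
      klein (horocycle a b w s) ∈ roundBall (n i) ↔ 0 < form (horocycle a b w s) (n i) :=
    fun s i => klein_mem_roundBall_iff (h.form_horocycle_self s) (h.ht_horocycle_pos s)
  refine exists_subset_of_isPreconnected (U := fun i => {s | 0 < form (horocycle a b w s) (n i)})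
    (fun i => ?_) (fun i j hij => ?_) hS hne fun s hs => ?_
  · exact isOpen_lt continuous_const
      (continuous_form.comp ((continuous_horocycle a b w).prodMk continuous_const))
  · exact disjoint_left.mpr fun s hi hj => disjoint_left.mp (hn.disjoint hij)
      (subset_closure ((mem_ball s i).mpr hi)) (subset_closure ((mem_ball s j).mpr hj))
  · have hsph := klein_mem_sphereInf (h.form_horocycle_self s) (h.ht_horocycle_pos s).ne'
    obtain ⟨i, hi⟩ := mem_iUnion.mp (hn.iUnion_eq ▸ mem_sdiff_of_mem hsph (hΛ s hs))
    exact mem_iUnion.mpr ⟨i, (mem_ball s i).mp hi⟩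

/-- If the horocycle avoids the limit set on both arcs, each arc lies in one ball; the two balls
differ because no ball meets a horocycle on both sides of a point outside it, and arcs of ratio `k`
force their boundary hyperplanes to be closer than `hsep` allows. -/
lemma exists_klein_horocycle_mem_limitSet (hn : IsBallDecomposition Γ n) {k : ℝ} (hk : 4 < k)
    (hsep : ∀ i j, i ≠ j → 1 + 8 / (k - 4) < -form (n i) (n j)) (h : IsHorocyclicFrame a b w)
    (ha : klein a ∈ limitSet Γ) (hb : klein b ∈ limitSet Γ) {r : ℝ} (hr : 0 < r) :
    ∃ s ∈ Icc (-(k * r)) (-r) ∪ Icc r (k * r), klein (horocycle a b w s) ∈ limitSet Γ := by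
  have hrk : r ≤ k * r := by nlinarith
  rcases h.form_self_nonneg.eq_or_lt with hw | hw
  · refine ⟨r, Or.inr ⟨le_rfl, hrk⟩, ?_⟩
    rwa [horocycle, h.eq_zero_of_form_self_eq_zero hw.symm, form_zero_left, mul_zero, zero_div,
      smul_zero, zero_smul, add_zero, add_zero]
  by_contra! hno
  obtain ⟨i, hi⟩ := exists_forall_form_horocycle_pos hn h isPreconnected_Icc
    (nonempty_Icc.mpr hrk) fun s hs => hno s (Or.inr hs)
  obtain ⟨j, hj⟩ := exists_forall_form_horocycle_pos hn h isPreconnected_Icc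
    (nonempty_Icc.mpr (neg_le_neg hrk)) fun s hs => hno s (Or.inl hs)
  have ha' := fun i => (hn.isComplementaryBall i).form_nonpos_of_klein_mem h.ht_left ha
  have hb' := fun i => (hn.isComplementaryBall i).form_nonpos_of_klein_mem h.ht_right hb
  have hi₁ := hi r ⟨le_rfl, hrk⟩
  have hj₁ := hj (-r) ⟨neg_le_neg hrk, le_rfl⟩
  have hij : i ≠ j := by
    rintro rfl
    linarith [h.neg_form_right_lt hi₁ (ha' i), h.neg_form_right_lt hj₁ (ha' i), hb' i]
  refine (hsep i j hij).not_ge (h.neg_form_le hw (hn.form_self i) (hn.form_self j) (ha' i) (ha' j)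
    (hb' i) (hb' j) hk hr hi₁ (hi _ ⟨hrk, le_rfl⟩) ?_ ?_)
  · rwa [horocycle_neg]
  · rw [horocycle_neg]
    exact hj _ ⟨le_rfl, neg_le_neg hrk⟩

lemma horocycle_zero (a b w : Vec d) : horocycle a b w 0 = b := by
  simp [horocycle]

namespace IsHorocyclicFrame

lemma form_add_smul_left_self (h : IsHorocyclicFrame a b w) (c : ℝ) :
    form (w + c • a) (w + c • a) = form w w := by
  simp only [form_add_left, form_add_right, form_smul_left, form_smul_right, form_comm a w,
    h.null_left, h.orth_left, mul_zero, add_zero]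

lemma horocycle_add (h : IsHorocyclicFrame a b w) (t s : ℝ) : horocycle a b w (t + s) =
    horocycle a (horocycle a b w t) (w + (t * form w w) • a) s := by
  rw [horocycle.eq_1 a (horocycle a b w t), h.form_add_smul_left_self, horocycle, horocycle]
  module

lemma rebase (h : IsHorocyclicFrame a b w) (t : ℝ) :
    IsHorocyclicFrame a (horocycle a b w t) (w + (t * form w w) • a) where
  null_left := h.null_left
  null_right := h.form_horocycle_self t
  form_eq := by
    rw [form_comm, form_horocycle, form_comm b, h.form_eq, h.orth_left, h.null_left]
    ring
  orth_left := by rw [form_add_left, form_smul_left, h.orth_left, h.null_left]; ring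
  orth_right := by
    simp only [horocycle, form_add_left, form_add_right, form_smul_left, form_smul_right,
      form_comm a w, h.orth_left, h.orth_right, h.form_eq, h.null_left]
    ring
  ht_left := h.ht_left
  ht_right := h.ht_horocycle_pos t

end IsHorocyclicFrame

lemma globallyThick_setOf_klein_horocycle_mem (hn : IsBallDecomposition Γ n) {k : ℝ} (hk : 4 < k)
    (hsep : ∀ i j, i ≠ j → 1 + 8 / (k - 4) < -form (n i) (n j)) (h : IsHorocyclicFrame a b w)
    (ha : klein a ∈ limitSet Γ) (hb : klein b ∈ limitSet Γ) :
    GloballyThick k {s | klein (horocycle a b w s) ∈ limitSet Γ} := by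
  refine ⟨(isClosed_limitSet Γ).preimage h.continuous_klein_horocycle, ⟨0, ?_⟩, fun t ht r hr => ?_⟩
  · rwa [mem_ofPred_eq, horocycle_zero]
  · obtain ⟨s, hs, hsΛ⟩ := exists_klein_horocycle_mem_limitSet hn hk hsep (h.rebase t) ha ht hr
    rw [← h.horocycle_add] at hsΛ
    refine ⟨t + s, hsΛ, hs.imp (fun hs => ?_) fun hs => ?_⟩ <;>
      exact ⟨by linarith [hs.1], by linarith [hs.2]⟩

/-! ### Return times of horospherical one-parameter groups -/

/-- The unipotent isometry that fixes the null vector `a` and translates the horospheres based at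
`a` by the vector `w` orthogonal to `a` (an Eichler transvection). -/
def transvection (a w v : Vec d) : Vec d :=
  v + form v w • a - form v a • w - (form v a * form w w / 2) • a

lemma transvection_transvection {a w w' : Vec d} (ha : form a a = 0) (hw : form w a = 0)
    (hw' : form w' a = 0) (v : Vec d) :
    transvection a w (transvection a w' v) = transvection a (w + w') v := by
  have hva : form (transvection a w' v) a = form v a := by
    simp only [transvection, form_add_left, form_sub_left, form_smul_left, ha, hw', mul_zero,
      add_zero, sub_zero]
  have hvw : form (transvection a w' v) w = form v w - form v a * form w' w := by
    simp only [transvection, form_add_left, form_sub_left, form_smul_left, form_comm a w, hw,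
      mul_zero, add_zero, sub_zero]
  rw [transvection, hva, hvw, transvection, transvection]
  simp only [form_add_left, form_add_right, form_comm w' w]
  module

lemma exp_mulVec_of_cube_eq_zero {ι : Type*} [Fintype ι] [DecidableEq ι] {A : Matrix ι ι ℝ}
    (hA : A ^ 3 = 0) (v : ι → ℝ) :
    (NormedSpace.exp A).mulVec v = v + A.mulVec v + (1 / 2 : ℝ) • A.mulVec (A.mulVec v) := by
  have hexp : NormedSpace.exp A = 1 + A + (1 / 2 : ℝ) • A ^ 2 := by
    rw [NormedSpace.exp_eq_tsum ℝ]
    change ∑' n : ℕ, ((n.factorial : ℝ)⁻¹) • A ^ n = _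
    rw [tsum_eq_sum (s := Finset.range 3) fun n hn => by
      rw [pow_eq_zero_of_le (not_lt.mp (Finset.mem_range.not.mp hn)) hA, smul_zero]]
    simp [Finset.sum_range_succ]
  rw [hexp, Matrix.add_mulVec, Matrix.add_mulVec, Matrix.smul_mulVec, Matrix.one_mulVec, pow_two,
    Matrix.mulVec_mulVec]

lemma exp_mulVec_eq_transvection {A : Matrix (Idx d) (Idx d) ℝ} {a w : Vec d}
    (ha : form a a = 0) (hw : form w a = 0)
    (hA : ∀ v, A.mulVec v = form v w • a - form v a • w) (v : Vec d) :
    (NormedSpace.exp A).mulVec v = transvection a w v := by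
  have hA₂ : ∀ v, A.mulVec (A.mulVec v) = -(form v a * form w w) • a := by
    intro v
    simp only [hA, form_sub_left, form_smul_left, ha, hw, form_comm a w]
    module
  have hA₃ : A ^ 3 = 0 := by
    refine Matrix.mulVec_injective (funext fun v => ?_)
    rw [pow_succ, pow_two, ← Matrix.mulVec_mulVec, ← Matrix.mulVec_mulVec, hA₂, hA]
    simp only [form_sub_left, form_smul_left, ha, hw, mul_zero, sub_zero, zero_mul, neg_zero,
      zero_smul, Matrix.zero_mulVec]
  rw [exp_mulVec_of_cube_eq_zero hA₃, hA₂, hA, transvection]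
  module

section Frame

variable {a b w : Vec d}

lemma mulVec_horocycle (g : G d) (a b w : Vec d) (s : ℝ) : g.mat.mulVec (horocycle a b w s) =
    horocycle (g.mat.mulVec a) (g.mat.mulVec b) (g.mat.mulVec w) s := by
  simp only [horocycle, Matrix.mulVec_add, Matrix.mulVec_smul, form_mat]

namespace IsHorocyclicFrame

lemma transvection_left (h : IsHorocyclicFrame a b w) : transvection a w a = a := by
  simp [transvection, h.null_left, form_comm a w, h.orth_left]

lemma transvection_smul_right (h : IsHorocyclicFrame a b w) (s : ℝ) :
    transvection a (s • w) b = horocycle a b w s := by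
  simp only [transvection, horocycle, form_smul_left, form_smul_right, form_comm b, h.form_eq,
    h.orth_right]
  module

lemma transvection_right_sub (h : IsHorocyclicFrame a b w) :
    transvection a w b - b + form (transvection a w b) b • a = w := by
  rw [← one_smul ℝ w, h.transvection_smul_right, form_horocycle, h.null_right, h.form_eq,
    h.orth_right, horocycle]
  module

end IsHorocyclicFrame

/-- The direction `W s` can be read off the image of `b`, so it is additive and continuous. -/
lemma eq_smul_of_isOneParameterSubgroup {u : ℝ → G d} (hu : IsOneParameterSubgroup u)
    {W : ℝ → Vec d} (hW : ∀ s, IsHorocyclicFrame a b (W s))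
    (htv : ∀ s v, (u s).mat.mulVec v = transvection a (W s) v) (s : ℝ) : W s = s • W 1 := by
  have hval : ∀ s, W s = (u s).mat.mulVec b - b + form ((u s).mat.mulVec b) b • a := fun s => by
    rw [htv, (hW s).transvection_right_sub]
  have hadd : ∀ s t, W (s + t) = W s + W t := fun s t => by
    have hst : IsHorocyclicFrame a b (W s + W t) :=
      { hW s with
        orth_left := by rw [form_add_left, (hW s).orth_left, (hW t).orth_left, add_zero]
        orth_right := by rw [form_add_left, (hW s).orth_right, (hW t).orth_right, add_zero] }
    rw [hval, hu.2, mulVec_mul, htv s, htv t,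
      transvection_transvection (hW s).null_left (hW s).orth_left (hW t).orth_left,
      hst.transvection_right_sub]
  have hcont : Continuous W := by
    have hub : Continuous fun s => (u s).mat.mulVec b :=
      (isClosedEmbedding_mat.continuous.comp hu.1).matrix_mulVec continuous_const
    rw [funext hval]
    exact (hub.sub continuous_const).add
      ((continuous_form.comp (hub.prodMk continuous_const)).smul continuous_const)
  have hlin : W (s • 1) = s • W 1 := map_real_smul (AddMonoidHom.mk' W hadd) hcont s 1
  rwa [smul_eq_mul, mul_one] at hlin

lemma globallyThick_returnTimes {ι : Type*} {Γ : Subgroup (G d)} {n : ι → Vec d}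
    (hn : IsBallDecomposition Γ n) {k : ℝ} (hk : 4 < k)
    (hsep : ∀ i j, i ≠ j → 1 + 8 / (k - 4) < -form (n i) (n j))
    (hRF : ∀ g : G d, (⟦g⟧ : FrameBundle Γ) ∈ RF Γ ↔
      klein (g.mat.mulVec a) ∈ limitSet Γ ∧ klein (g.mat.mulVec b) ∈ limitSet Γ)
    {u : ℝ → G d} (hu : IsOneParameterSubgroup u)
    (htv : ∀ s, ∃ w, IsHorocyclicFrame a b w ∧ ∀ v, (u s).mat.mulVec v = transvection a w v)
    {y : FrameBundle Γ} (hy : y ∈ RF Γ) : GloballyThick k (returnTimes u y) := by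
  choose W hW htv using htv
  have hub : ∀ s, (u s).mat.mulVec b = horocycle a b (W 1) s := fun s => by
    rw [htv, eq_smul_of_isOneParameterSubgroup hu hW htv, (hW 1).transvection_smul_right]
  obtain ⟨g, rfl⟩ := Quotient.exists_rep y
  obtain ⟨hga, hgb⟩ := (hRF g).mp hy
  have hT : returnTimes u (⟦g⟧ : FrameBundle Γ) = {t | klein (horocycle (g.mat.mulVec a)
      (g.mat.mulVec b) (g.mat.mulVec (W 1)) t) ∈ limitSet Γ} := by
    ext t
    change (⟦g * u t⟧ : FrameBundle Γ) ∈ RF Γ ↔ _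
    rw [hRF, mulVec_mul, mulVec_mul, htv t a, (hW t).transvection_left, hub, mulVec_horocycle]
    exact and_iff_right hga
  rw [hT]
  exact globallyThick_setOf_klein_horocycle_mem hn hk hsep ((hW 1).mulVec g) hga hgb

end Frame

/-- The null vector with `g⁺ = klein (g ePlus)`. -/
def ePlus (d : ℕ) : Vec d := Pi.single (fstI d) 1

/-- The null vector with `g⁻ = klein (g eMinus)`, the sign being chosen such that its height is
positive. -/
def eMinus (d : ℕ) : Vec d := -Pi.single (lstI d) 1

/-- The vector with middle block `x` and outer coordinates zero. -/
def midVec (x : Fin (d - 1) → ℝ) : Vec d := Sum.elim 0 (Sum.elim x 0)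

lemma isHorocyclicFrame_midVec (x : Fin (d - 1) → ℝ) :
    IsHorocyclicFrame (ePlus d) (eMinus d) (midVec x) := by
  constructor <;> simp [form, ht, ePlus, eMinus, midVec]

lemma uMinus_mulVec (x : Fin (d - 1) → ℝ) (v : Vec d) : (uMinus x).mulVec v =
    form v (midVec x) • ePlus d - form v (ePlus d) • midVec x := by
  funext i
  rcases i with ⟨⟩ | i | ⟨⟩ <;>
    simp [Matrix.mulVec, dotProduct, uMinus, midVec, form, ePlus, mul_comm]

lemma uPlus_mulVec (x : Fin (d - 1) → ℝ) (v : Vec d) : (uPlus x).mulVec v =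
    form v (midVec x) • eMinus d - form v (eMinus d) • midVec x := by
  funext i
  rcases i with ⟨⟩ | i | ⟨⟩ <;>
    simp [Matrix.mulVec, dotProduct, uPlus, midVec, form, eMinus, mul_comm]

lemma exists_transvection_of_mem_NMinus {g : G d} (hg : g ∈ NMinus d) :
    ∃ w, IsHorocyclicFrame (ePlus d) (eMinus d) w ∧
      ∀ v, g.mat.mulVec v = transvection (ePlus d) w v := by
  obtain ⟨x, hx⟩ := hg
  have h := isHorocyclicFrame_midVec x
  exact ⟨midVec x, h, fun v => by
    rw [hx, exp_mulVec_eq_transvection h.null_left h.orth_left (uMinus_mulVec x)]⟩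

lemma exists_transvection_of_mem_NPlus {g : G d} (hg : g ∈ NPlus d) :
    ∃ w, IsHorocyclicFrame (eMinus d) (ePlus d) w ∧
      ∀ v, g.mat.mulVec v = transvection (eMinus d) w v := by
  obtain ⟨x, hx⟩ := hg
  have h := (isHorocyclicFrame_midVec x).swap
  exact ⟨midVec x, h, fun v => by
    rw [hx, exp_mulVec_eq_transvection h.null_left h.orth_left (uPlus_mulVec x)]⟩

lemma G.minus_eq (g : G d) : g.minus = klein (g.mat.mulVec (eMinus d)) := by
  rw [eMinus, Matrix.mulVec_neg, ← neg_one_smul ℝ, klein_smul (by norm_num)]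
  rfl

lemma mk_mem_RF_iff {Γ : Subgroup (G d)} {g : G d} : (⟦g⟧ : FrameBundle Γ) ∈ RF Γ ↔
    klein (g.mat.mulVec (ePlus d)) ∈ limitSet Γ ∧ klein (g.mat.mulVec (eMinus d)) ∈ limitSet Γ := by
  rw [← G.minus_eq]
  refine ⟨?_, fun h => ⟨g, h, rfl⟩⟩
  rintro ⟨g', ⟨hplus, hminus⟩, hg⟩
  obtain ⟨γ, rfl⟩ : ∃ γ : Γ, γ • g = g' := MulAction.orbitRel_apply.mp (Quotient.exact hg)
  have hframe := (isHorocyclicFrame_midVec (0 : Fin (d - 1) → ℝ)).mulVec g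
  have hmat : ∀ v, (γ • g).mat.mulVec v = (γ : G d).mat.mulVec (g.mat.mulVec v) :=
    mulVec_mul (γ : G d) g
  rw [G.minus_eq] at hminus ⊢
  rw [G.plus, hmat] at hplus
  rw [hmat] at hminus
  exact ⟨(klein_mulVec_mem_limitSet_iff γ.2 hframe.null_left hframe.ht_left).mp hplus,
    (klein_mulVec_mem_limitSet_iff γ.2 hframe.null_right hframe.ht_right).mp hminus⟩

/-- The thickness constant as a function of the systole; it makes the bound `1 + 8 / (k - 4)` of
`IsHorocyclicFrame.neg_form_le` smaller than `cosh (η / 2)`. -/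
def thicknessConst (η : ℝ) : ℝ := 5 + 8 / (Real.cosh (η / 2) - 1)

lemma five_lt_thicknessConst {η : ℝ} (hη : 0 < η) : 5 < thicknessConst η :=
  lt_add_of_pos_right 5 (div_pos (by norm_num) (sub_pos.mpr (Real.one_lt_cosh.mpr (by positivity))))

lemma one_add_div_thicknessConst_lt {η : ℝ} (hη : 0 < η) :
    1 + 8 / (thicknessConst η - 4) < Real.cosh (η / 2) := by
  have hc : 0 < Real.cosh (η / 2) - 1 := sub_pos.mpr (Real.one_lt_cosh.mpr (by positivity))
  rw [← lt_sub_iff_add_lt', div_lt_iff₀ (by linarith [five_lt_thicknessConst hη]), thicknessConst]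
  calc 8 < Real.cosh (η / 2) - 1 + 8 := lt_add_of_pos_left 8 hc
    _ = (Real.cosh (η / 2) - 1) * (5 + 8 / (Real.cosh (η / 2) - 1) - 4) := by field_simp; ring

end FuchsianEnds

end

open FuchsianEnds in
theorem proposition4p12_general {d : ℕ} (hd : 2 ≤ d) {Γ : Subgroup (G d)} [DiscreteTopology Γ]
    (htf : ∀ γ ∈ Γ, IsOfFinOrder γ → γ = 1) {ι : Type*} {n : ι → Vec d}
    (hn : ∀ i, form (n i) (n i) = 1) (hunion : sphereInf d \ limitSet Γ = ⋃ i, roundBall (n i))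
    (hdis : Pairwise fun i j => Disjoint (closure (roundBall (n i))) (closure (roundBall (n j))))
    {η : ℝ} (hη : 0 < η) (hsys : η ∈ lowerBounds {ℓ | HasClosedGeodesic Γ ℓ}) {u : ℝ → G d}
    (hu : IsOneParameterSubgroup u) (hN : (∀ t, u t ∈ NMinus d) ∨ ∀ t, u t ∈ NPlus d)
    {y : FrameBundle Γ} (hy : y ∈ RF Γ) :
    GloballyThick (thicknessConst η) (returnTimes u y) := by
  have balls : IsBallDecomposition Γ n := ⟨hn, hunion, hdis⟩
  have hk : 4 < thicknessConst η := by linarith [five_lt_thicknessConst hη]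
  have hsep : ∀ i j, i ≠ j → 1 + 8 / (thicknessConst η - 4) < -form (n i) (n j) :=
    fun i j hij => (one_add_div_thicknessConst_lt hη).trans_le <|
      cosh_half_systole_le hd htf hη hsys (balls.isComplementaryBall i)
        (balls.isComplementaryBall j) (hdis hij)
  rcases hN with hN | hN
  · exact globallyThick_returnTimes balls hk hsep (fun g => mk_mem_RF_iff) hu
      (fun s => exists_transvection_of_mem_NMinus (hN s)) hy
  · exact globallyThick_returnTimes balls hk hsep (fun g => mk_mem_RF_iff.trans and_comm) hu
      (fun s => exists_transvection_of_mem_NPlus (hN s)) hy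

theorem proposition4p12 :
    ∃ k : ℝ → ℝ, (∀ η > 0, 1 < k η) ∧
      ∀ (d : ℕ), 2 ≤ d → ∀ Γ : Subgroup (FuchsianEnds.G d),
        FuchsianEnds.IsConvexCocompactFuchsianEnds Γ →
        ∀ η : ℝ, FuchsianEnds.IsSystoleOfDouble Γ η →
        ∀ u : ℝ → FuchsianEnds.G d, FuchsianEnds.IsOneParameterSubgroup u →
          ((∀ t, u t ∈ FuchsianEnds.NMinus d) ∨ (∀ t, u t ∈ FuchsianEnds.NPlus d)) →
        ∀ y ∈ FuchsianEnds.RF Γ,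
          FuchsianEnds.GloballyThick (k η) (FuchsianEnds.returnTimes u y) := by
  refine ⟨FuchsianEnds.thicknessConst, fun η hη => ?_, ?_⟩
  · linarith [FuchsianEnds.five_lt_thicknessConst hη]
  intro d hd Γ hΓ η hη u hu hN y hy
  have := hΓ.discrete
  obtain ⟨n, hn, hunion, hdis, -⟩ := hΓ.exists_balls
  exact proposition4p12_general hd hΓ.torsionFree hn hunion hdis hη.1.1 hη.2 hu hN hy
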